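/- Let $\Bbbk$ be a field of characteristic different from $2$ and let $N=|\mathbf x|\ge 0$. Let $\mathcal C$ be the KLRW category with $N$ punctures, regarded as an $A_\infty$-category: its objects are $T_0,\dots,T_N$; $\mathrm{Hom}(T_i,T_j)=\bigoplus_{\alpha\ge 0}\Bbbk\,a_{ji}s^\alpha$ is concentrated in degree $0$; $\mu^d=0$ for $d\neq 2$, and $$\mu^2(a_{kj}s^\beta,a_{ji}s^\alpha)=a_{ki}s^{\beta+\alpha+\delta(i,j,k)},\qquad \delta(i,j,k)=\begin{cases}0,&(i-j)(j-k)\ge 0,\\ \min(|i-j|,|j-k|),&(i-j)(j-k)<0.\end{cases}$$ Let $\mathrm{HH}^2(\Delta)=H^2\mathrm{Hom}(\mathrm{id},\mathrm{id})$ be the space of degree-$2$ $A_\infty$-natural transformations $\mathrm{id}_{\mathcal C}\Rightarrow\mathrm{id}_{\mathcal C}$ (degree-$2$ pre-natural transformations $\eta=(\eta^d)_{d\ge0}$, $\eta^d$ of degree $2-d$, with $\mu^1(\eta)=0$) modulo those of the form $\mu^1(\theta)$ with $\theta$ a pre-natural transformation of degree $1$. For $\vartheta=(\vartheta_1,\dots,\vartheta_{N-1})\in\Bbbk^{N-1}$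 (with $\Bbbk^{N-1}:=0$ if $N=0$) put $\vartheta_0=\vartheta_N=0$ and $$\mathfrak C(a_{kj}s^\beta,a_{ji}s^\alpha)=\begin{cases} -\beta\vartheta_j-\sum_{t=1}^{j-i-1}2\beta\,\vartheta_{j-t}-\beta\vartheta_i,& i<j<k,\\ -\beta\vartheta_j-\sum_{t=1}^{j-k}2(\beta+t)\vartheta_{j-t}-\sum_{t=j-k+1}^{j-i-1}2(\beta+j-k)\vartheta_{j-t}-(\beta+j-k)\vartheta_i,& i<k\le j,\\ -\beta\vartheta_j-\sum_{t=1}^{j-i}2(\beta+t)\vartheta_{j-t}+(\beta+j-i)\vartheta_i,& k\le i<j,\\ \beta\vartheta_j+\sum_{t=1}^{i-j-1}2\beta\,\vartheta_{j+t}+\beta\vartheta_i,& k<j<i,\\ \beta\vartheta_j+\sum_{t=1}^{k-j}2(\beta+t)\vartheta_{j+t}+\sum_{t=k-j+1}^{i-j-1}2(\beta+k-j)\vartheta_{j+t}+(\beta+k-j)\vartheta_i,& j\le k<i,\\ \beta\vartheta_j+\sum_{t=1}^{i-j}2(\beta+t)\vartheta_{j+t}-(\beta+i-j)\vartheta_i,&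 j<i\le k,\\ 0,& i=j. \end{cases}$$ Then for every $\vartheta\in\Bbbk^{N-1}$ there is a degree-$2$ $A_\infty$-natural transformation $\eta_\vartheta\colon\mathrm{id}\Rightarrow\mathrm{id}$, depending linearly on $\vartheta$, with $$\eta_\vartheta^2(a_{kj}s^\beta,a_{ji}s^\alpha)=\mathfrak C(a_{kj}s^\beta,a_{ji}s^\alpha)\,a_{ki}s^{\beta+\alpha+\delta(i,j,k)-1},\qquad \eta_\vartheta^d=0\ \text{ for } d\ne 2$$ (where $\mathfrak C\neq0$ forces $\beta+\alpha+\delta(i,j,k)\ge1$), and $\vartheta\mapsto[\eta_\vartheta]$ is a linear isomorphism $\Bbbk^{N-1}\cong\mathrm{HH}^2(\Delta)$. Moreover $\mathfrak C$ is given by the following strand-sliding rule. Draw the path $a_{kj}s^\beta a_{ji}$ as a black strand from position $i$ (bottom) to position $j$, where it carries $\beta$ dots, to position $k$ (top), and slide its middle part from $j$ to $i$ across one red strand at a time. If $j>i$, sliding the middle with $b$ dots from $m$ to $m-1$ contributes $b(\vartheta_m+\vartheta_{m-1})$; if moreover $k<m$ (so that the strand turns back), it contributes an additional $\vartheta_{m-1}$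 and the number of dots in the middle becomes $b+1$, while otherwise it stays $b$. If $j<i$, the rule is the mirror image, with $m+1$ in place of $m-1$ and $k>m$ in place of $k<m$. Then $\mathfrak C$ is the sum of all contributions, with an overall minus sign if $j>i$. -/

import Mathlib

open Finset

noncomputable section

namespace KLRW

/-! ### The KLRW category with `N` punctures

Objects `T_0, …, T_N`; the space of morphisms `T_i ⟶ T_j` has the basis `a_{ji} s^α` (`α ∈ ℕ`), all in
degree `0`; `μ² (a_{kj} s^β, a_{ji} s^α) = a_{ki} s^{β+α+δ(i,j,k)}` and `μ^d = 0` for `d ≠ 2`. -/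

/-- The objects `T_0, …, T_N`. -/
abbrev Ob (N : ℕ) : Type := Fin (N + 1)

/-- The morphisms `T_i ⟶ T_j`; the coefficient at `α` is the one of `a_{ji} s^α`. -/
abbrev Mor (k : Type*) [Field k] {N : ℕ} (_i _j : Ob N) : Type _ := ℕ →₀ k

/-- The basis element `a_{ji} s^α` of the morphisms `T_i ⟶ T_j`. -/
def gen (k : Type*) [Field k] {N : ℕ} (j i : Ob N) (α : ℕ) : Mor k i j := Finsupp.single α 1

/-- The degree `g` part of the graded space of morphisms: everything is in degree `0`. -/
def degPart (k : Type*) [Field k] {N : ℕ} (i j : Ob N) (g : ℤ) : Submodule k (Mor k i j) :=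
  if g = 0 then ⊤ else ⊥

/-- `δ(i,j,l)`. -/
def delta (i j l : ℕ) : ℕ :=
  if 0 ≤ ((i : ℤ) - j) * ((j : ℤ) - l) then 0
  else min ((i : ℤ) - j).natAbs ((j : ℤ) - l).natAbs

/-- The bilinear composition `a_{lj} s^β ⊗ a_{ji} s^α ↦ a_{li} s^{β+α+δ(i,j,l)}`. -/
def comp (k : Type*) [Field k] {N : ℕ} (i j l : Ob N) :
    Mor k j l →ₗ[k] Mor k i j →ₗ[k] Mor k i l :=
  Finsupp.linearCombination k (fun β : ℕ =>
    Finsupp.lmapDomain k k (fun α : ℕ => β + α + delta i j l))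

/-- Families of multilinear maps `Hom(X_{d-1},X_d) ⊗ ⋯ ⊗ Hom(X_0,X_1) → Hom(X_0,X_d)`, one for each
`d ≥ 0` and each `X_0, …, X_d`. The argument with index `p : Fin d` is the morphism
`a_{p+1} : X_p ⟶ X_{p+1}`, so the arguments are listed in the order `a_1, …, a_d`. -/
def Family (k : Type*) [Field k] (N : ℕ) : Type _ :=
  ∀ (d : ℕ) (X : Fin (d + 1) → Ob N),
    MultilinearMap k (fun p : Fin d => Mor k (X p.castSucc) (X p.succ))
      (Mor k (X 0) (X (Fin.last d)))

/-- Families are added componentwise. -/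
instance (k : Type*) [Field k] (N : ℕ) : AddCommGroup (Family k N) :=
  inferInstanceAs (AddCommGroup (∀ (d : ℕ) (X : Fin (d + 1) → Ob N),
    MultilinearMap k (fun p : Fin d => Mor k (X p.castSucc) (X p.succ))
      (Mor k (X 0) (X (Fin.last d)))))

/-- Scalars act on families componentwise. -/
instance (k : Type*) [Field k] (N : ℕ) : Module k (Family k N) :=
  inferInstanceAs (Module k (∀ (d : ℕ) (X : Fin (d + 1) → Ob N),
    MultilinearMap k (fun p : Fin d => Mor k (X p.castSucc) (X p.succ))
      (Mor k (X 0) (X (Fin.last d)))))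

/-- The structure maps `μ^d`. -/
def mu (k : Type*) [Field k] (N : ℕ) : Family k N
  | 2, X =>
    { toFun := fun a => comp k (X 0) (X 1) (X 2) (a 1) (a 0)
      map_update_add' := by
        intro _ m p x y
        fin_cases p <;> simp [Function.update]
      map_update_smul' := by
        intro _ m p c x
        fin_cases p <;> simp [Function.update] }
  | _, _ => 0

/-! ### `A_∞`-pre-natural transformations `id ⇒ id`, their differential, Hochschild cohomology -/

/-- Degree `g` pre-natural transformations `η : id ⇒ id`: families in which `η^d` has
degree `g - d`. -/
def PreNat (k : Type*) [Field k] (N : ℕ) (g : ℤ) : Submodule k (Family k N) where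
  carrier := {η | ∀ (d : ℕ) (X : Fin (d + 1) → Ob N) (e : Fin d → ℤ)
    (a : ∀ p : Fin d, Mor k (X p.castSucc) (X p.succ)),
    (∀ p, a p ∈ degPart k (X p.castSucc) (X p.succ) (e p)) →
      η d X a ∈ degPart k (X 0) (X (Fin.last d)) (∑ p, e p + g - d)}
  add_mem' h h' d X e a ha := Submodule.add_mem _ (h d X e a ha) (h' d X e a ha)
  zero_mem' _ _ _ _ _ := Submodule.zero_mem _
  smul_mem' c _ h d X e a ha := Submodule.smul_mem _ c (h d X e a ha)

/-- The value `η^d(a_d, …, a_1)` on the first `d` members of a composable sequence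
`X_0 ⟶ X_1 ⟶ X_2 ⟶ ⋯`, where `a p : X_p ⟶ X_{p+1}` is the morphism `a_{p+1}`. -/
def ev {k : Type*} [Field k] {N : ℕ} (η : Family k N) (d : ℕ) (X : ℕ → Ob N)
    (a : ∀ p, Mor k (X p) (X (p + 1))) : Mor k (X 0) (X d) :=
  η d (fun p => X p) (fun p => a p)

/-- The value `η^s(a_{n+s}, …, a_{n+1})`. -/
def evFrom {k : Type*} [Field k] {N : ℕ} (η : Family k N) (n s : ℕ) (X : ℕ → Ob N)
    (a : ∀ p, Mor k (X p) (X (p + 1))) : Mor k (X n) (X (n + s)) :=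
  ev η s (fun p => X (n + p)) (fun p => a (n + p))

/-- The objects `X_0, …, X_n, X_{n+s}, X_{n+s+1}, …`. -/
def contractOb {N : ℕ} (n s : ℕ) (X : ℕ → Ob N) (p : ℕ) : Ob N :=
  if p ≤ n then X p else X (p + s - 1)

/-- The morphisms `a_1, …, a_n, v, a_{n+s+1}, a_{n+s+2}, …` (with `v : X_n ⟶ X_{n+s}`). -/
def contractMor {k : Type*} [Field k] {N : ℕ} (n s : ℕ) (X : ℕ → Ob N)
    (a : ∀ p, Mor k (X p) (X (p + 1))) (v : Mor k (X n) (X (n + s))) (p : ℕ) :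
    Mor k (contractOb n s X p) (contractOb n s X (p + 1)) :=
  if p < n then a p else if p = n then v else a (p + s - 1)

/-- The value `η^{d-s+1}(a_d, …, a_{n+s+1}, ζ^s(a_{n+s}, …, a_{n+1}), a_n, …, a_1)`. -/
def brace {k : Type*} [Field k] {N : ℕ} (η ζ : Family k N) (d n s : ℕ) (X : ℕ → Ob N)
    (a : ∀ p, Mor k (X p) (X (p + 1))) : Mor k (X 0) (X d) :=
  ev η (d - s + 1) (contractOb n s X) (contractMor n s X a (evFrom ζ n s X a))

/-- `✠_n = |a_1| + ⋯ + |a_n| - n`; here every morphism has degree `0`. -/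
def maltese (n : ℕ) : ℤ := -(n : ℤ)

/-- The differential `μ¹(η)^d(a_d, …, a_1)` of a degree `g` pre-natural transformation
`η : id ⇒ id`, namely
`∑ (-1)^{(g-1)✠_n} μ^{d-s+1}(a_d, …, η^s(a_{n+s}, …, a_{n+1}), a_n, …, a_1)`
`- ∑ (-1)^{✠_n+g-1} η^{d-m+1}(a_d, …, μ^m(a_{n+m}, …, a_{n+1}), a_n, …, a_1)`. -/
def diffFun {k : Type*} [Field k] {N : ℕ} (g : ℤ) (η : Family k N) (d : ℕ) (X : ℕ → Ob N)
    (a : ∀ p, Mor k (X p) (X (p + 1))) : Mor k (X 0) (X d) :=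
  ∑ s ∈ range (d + 1), ∑ n ∈ range (d - s + 1),
      (-1 : k) ^ ((g - 1) * maltese n) • brace (mu k N) η d n s X a
    - ∑ m ∈ range (d + 1), ∑ n ∈ range (d - m + 1),
      (-1 : k) ^ (maltese n + g - 1) • brace η (mu k N) d n m X a

/-- Functions on composable sequences, the home of the values of the differential. -/
abbrev Values (k : Type*) [Field k] (N : ℕ) : Type _ :=
  ∀ (d : ℕ) (X : ℕ → Ob N), (∀ p, Mor k (X p) (X (p + 1))) → Mor k (X 0) (X d)

theorem contractMor_eq_update {k : Type*} [Field k] {N : ℕ} (d n s : ℕ) (hn : n < d)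
    (X : ℕ → Ob N) (a : ∀ p, Mor k (X p) (X (p + 1))) (v : Mor k (X n) (X (n + s))) :
    (fun p : Fin d => contractMor n s X a v p) =
      Function.update (fun p : Fin d => contractMor n s X a 0 p) ⟨n, hn⟩ v := by
  funext p
  by_cases h : p = ⟨n, hn⟩
  · subst h
    simp [contractMor]
  · have h' : (p : ℕ) ≠ n := fun e => h (Fin.ext e)
    simp [Function.update, h, contractMor, h']

theorem brace_add_right {k : Type*} [Field k] {N : ℕ} (η ζ ζ' : Family k N) {d n s : ℕ}
    (h : n < d - s + 1) (X : ℕ → Ob N) (a : ∀ p, Mor k (X p) (X (p + 1))) :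
    brace η (ζ + ζ') d n s X a = brace η ζ d n s X a + brace η ζ' d n s X a := by
  have e : evFrom (ζ + ζ') n s X a = evFrom ζ n s X a + evFrom ζ' n s X a := rfl
  simp only [brace, e]
  unfold ev
  rw [contractMor_eq_update _ n s h, contractMor_eq_update _ n s h X a (evFrom ζ n s X a),
    contractMor_eq_update _ n s h X a (evFrom ζ' n s X a)]
  exact MultilinearMap.map_update_add _ _ _ _ _

theorem brace_smul_right {k : Type*} [Field k] {N : ℕ} (c : k) (η ζ : Family k N) {d n s : ℕ}
    (h : n < d - s + 1) (X : ℕ → Ob N) (a : ∀ p, Mor k (X p) (X (p + 1))) :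
    brace η (c • ζ) d n s X a = c • brace η ζ d n s X a := by
  have e : evFrom (c • ζ) n s X a = c • evFrom ζ n s X a := rfl
  simp only [brace, e]
  unfold ev
  rw [contractMor_eq_update _ n s h, contractMor_eq_update _ n s h X a (evFrom ζ n s X a)]
  exact MultilinearMap.map_update_smul _ _ _ _ _

/-- The differential as a linear map. -/
def diff (k : Type*) [Field k] (N : ℕ) (g : ℤ) : Family k N →ₗ[k] Values k N where
  toFun η := diffFun g η
  map_add' η η' := by
    funext d X a
    have h1 : ∀ s ∈ range (d + 1), ∀ n ∈ range (d - s + 1),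
        (-1 : k) ^ ((g - 1) * maltese n) • brace (mu k N) (η + η') d n s X a =
          (-1 : k) ^ ((g - 1) * maltese n) • brace (mu k N) η d n s X a +
          (-1 : k) ^ ((g - 1) * maltese n) • brace (mu k N) η' d n s X a := by
      intro s _ n hn
      rw [brace_add_right _ _ _ (mem_range.1 hn), smul_add]
    have h2 : ∀ m n, (-1 : k) ^ (maltese n + g - 1) • brace (η + η') (mu k N) d n m X a =
          (-1 : k) ^ (maltese n + g - 1) • brace η (mu k N) d n m X a +
          (-1 : k) ^ (maltese n + g - 1) • brace η' (mu k N) d n m X a := by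
      intro m n
      rw [← smul_add]
      rfl
    change diffFun g (η + η') d X a = diffFun g η d X a + diffFun g η' d X a
    unfold diffFun
    rw [sum_congr rfl (fun s hs => sum_congr rfl (h1 s hs)),
      sum_congr rfl (fun m _ => sum_congr rfl (fun n _ => h2 m n))]
    simp only [sum_add_distrib]
    abel
  map_smul' c η := by
    funext d X a
    have h1 : ∀ s ∈ range (d + 1), ∀ n ∈ range (d - s + 1),
        (-1 : k) ^ ((g - 1) * maltese n) • brace (mu k N) (c • η) d n s X a =
          c • ((-1 : k) ^ ((g - 1) * maltese n) • brace (mu k N) η d n s X a) := by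
      intro s _ n hn
      rw [brace_smul_right _ _ _ (mem_range.1 hn), smul_comm]
    have h2 : ∀ m n, (-1 : k) ^ (maltese n + g - 1) • brace (c • η) (mu k N) d n m X a =
          c • ((-1 : k) ^ (maltese n + g - 1) • brace η (mu k N) d n m X a) := by
      intro m n
      rw [smul_comm c]
      rfl
    change diffFun g (c • η) d X a = c • diffFun g η d X a
    unfold diffFun
    rw [sum_congr rfl (fun s hs => sum_congr rfl (h1 s hs)),
      sum_congr rfl (fun m _ => sum_congr rfl (fun n _ => h2 m n))]
    simp only [← smul_sum, ← smul_sub]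

/-- A family, as a function on composable sequences. -/
def evLin (k : Type*) [Field k] (N : ℕ) : Family k N →ₗ[k] Values k N where
  toFun η := ev η
  map_add' _ _ := rfl
  map_smul' _ _ := rfl

/-- Degree `g` `A_∞`-natural transformations `id ⇒ id`: pre-natural transformations `η` with
`μ¹(η) = 0`. -/
def NatTrans (k : Type*) [Field k] (N : ℕ) (g : ℤ) : Submodule k (Family k N) :=
  PreNat k N g ⊓ LinearMap.ker (diff k N g)

/-- Degree `g` coboundaries: the pre-natural transformations of the form `μ¹(θ)`, with `θ` a
pre-natural transformation of degree `g - 1`. -/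
def Cobound (k : Type*) [Field k] (N : ℕ) (g : ℤ) : Submodule k (Family k N) :=
  PreNat k N g ⊓ ((PreNat k N (g - 1)).map (diff k N (g - 1))).comap (evLin k N)

/-- The Hochschild cohomology `HH^g(Δ) = H^g Hom(id, id)`: natural transformations modulo
coboundaries. -/
abbrev HH (k : Type*) [Field k] (N : ℕ) (g : ℤ) : Type _ :=
  NatTrans k N g ⧸ (Cobound k N g).submoduleOf (NatTrans k N g)

/-- The class of a natural transformation in `HH^g(Δ)`. -/
def HH.mk (k : Type*) [Field k] (N : ℕ) (g : ℤ) : NatTrans k N g →ₗ[k] HH k N g :=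
  ((Cobound k N g).submoduleOf (NatTrans k N g)).mkQ

/-! ### The coefficient -/

/-- `ϑ_m` for `m ∈ ℕ`: the parameters are `ϑ_1, …, ϑ_{N-1}`, and `ϑ_0 = ϑ_N = 0`. -/
def param {k : Type*} [Field k] {N : ℕ} (ϑ : Fin (N - 1) → k) (m : ℕ) : k :=
  if h : 1 ≤ m ∧ m < N then ϑ ⟨m - 1, by omega⟩ else 0

/-- The coefficient `ℭ(a_{lj} s^β, a_{ji} s^α)`, which does not depend on `α`, in terms of a sequence
`θ_0, θ_1, …` of scalars. -/
def coeff {k : Type*} [Field k] (θ : ℕ → k) (l j i β : ℕ) : k :=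
  if i < j ∧ j < l then
    -(β * θ j) - ∑ t ∈ Ico 1 (j - i), 2 * β * θ (j - t) - β * θ i
  else if i < l ∧ l ≤ j then
    -(β * θ j) - ∑ t ∈ Icc 1 (j - l), 2 * (β + t) * θ (j - t)
      - ∑ t ∈ Ioo (j - l) (j - i), 2 * (β + (j - l : ℕ)) * θ (j - t)
      - (β + (j - l : ℕ)) * θ i
  else if l ≤ i ∧ i < j then
    -(β * θ j) - ∑ t ∈ Icc 1 (j - i), 2 * (β + t) * θ (j - t) + (β + (j - i : ℕ)) * θ i
  else if l < j ∧ j < i then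
    β * θ j + ∑ t ∈ Ico 1 (i - j), 2 * β * θ (j + t) + β * θ i
  else if j ≤ l ∧ l < i then
    β * θ j + ∑ t ∈ Icc 1 (l - j), 2 * (β + t) * θ (j + t)
      + ∑ t ∈ Ioo (l - j) (i - j), 2 * (β + (l - j : ℕ)) * θ (j + t)
      + (β + (l - j : ℕ)) * θ i
  else if j < i ∧ i ≤ l then
    β * θ j + ∑ t ∈ Icc 1 (i - j), 2 * (β + t) * θ (j + t) - (β + (i - j : ℕ)) * θ i
  else 0

/-- Sliding a black strand that bends to the right. The strand starts at `i`, has its middle at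
`j = i + n` with `β` dots there, and ends at `l`. Sliding the middle across the red strand between `j - 1`
and `j` meets the subpath `s_j^β p_j` and contributes `β (θ_j + θ_{j-1})`. If `l < j`, there is a
`q_{j-1}` above; it contributes another `θ_{j-1}`, and `q_{j-1} p_j = s_{j-1}` is a new dot. -/
def slideRight {k : Type*} [Field k] (θ : ℕ → k) (l i : ℕ) : ℕ → ℕ → k
  | 0, _ => 0
  | n + 1, β =>
    β * (θ (i + n + 1) + θ (i + n)) +
      if l < i + n + 1 then θ (i + n) + slideRight θ l i n (β + 1) else slideRight θ l i n β

/-- Sliding a black strand that bends to the left (the mirror image): the middle is at `j` with `β`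
dots, and `n` red strands are left to cross before the middle reaches the start `i = j + n`. -/
def slideLeft {k : Type*} [Field k] (θ : ℕ → k) (l : ℕ) : ℕ → ℕ → ℕ → k
  | 0, _, _ => 0
  | n + 1, j, β =>
    β * (θ j + θ (j + 1)) +
      if j < l then θ (j + 1) + slideLeft θ l n (j + 1) (β + 1) else slideLeft θ l n (j + 1) β

/-- The sum of all the contributions when the strand diagram of the path `a_{lj} s^β a_{ji} s^α` is
straightened, with a minus sign if the strand bends to the right. -/
def slide {k : Type*} [Field k] (θ : ℕ → k) (l j i β : ℕ) : k :=
  if i < j then -slideRight θ l i (j - i) β else slideLeft θ l (i - j) j β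

end KLRW

end

/-!
All morphisms have degree `0`, so a degree-2 pre-natural transformation is a Hochschild 2-cochain
and `HH²` is ordinary Hochschild cohomology. A 2-cocycle defines a square-zero extension of the
category, and it is a coboundary exactly if the extension splits. The KLRW category is generated
by arrows `p_i : i ⟶ i + 1` and `q_i : i + 1 ⟶ i`, and its relations identify the two round trips
to the neighbours of each of the `N - 1` interior vertices; both are the loop `s`. So a splitting
is a lift of the arrows that preserves these relations. Changing the lift of an arrow changes round
trips by multiples of `s`, hence the only obstruction at an interior vertex is a constant term.

After adjoining `s⁻¹`, the cochain with coefficients `ℭ` is the differential of an explicit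
1-cochain; this gives the cocycle condition. Its obstruction is `2 ϑ`, which is where the
characteristic enters.
-/

noncomputable section

namespace KLRW

section SquareZero

open CategoryTheory

universe v u

variable {k : Type*} {C : Type u} [CommRing k] [Category.{v} C] [Preadditive C] [Linear k C]

/-- Hochschild 2-cochains of a linear category with values in itself. The two arguments are in
diagrammatic order. -/
abbrev TwoCochain (k : Type*) (C : Type u) [CommRing k] [Category.{v} C] [Preadditive C]
    [Linear k C] :=
  ∀ X Y Z : C, (X ⟶ Y) →ₗ[k] (Y ⟶ Z) →ₗ[k] (X ⟶ Z)

/-- The Hochschild cocycle condition for 2-cochains. -/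
def TwoCochain.IsCocycle (f : TwoCochain k C) : Prop :=
  ∀ ⦃W X Y Z : C⦄ (x : W ⟶ X) (y : X ⟶ Y) (z : Y ⟶ Z),
    f W X Y x y ≫ z + f W Y Z (x ≫ y) z = x ≫ f X Y Z y z + f W X Z x (y ≫ z)

/-- The 2-cochains that are Hochschild differentials of 1-cochains. -/
def TwoCochain.IsCoboundary (f : TwoCochain k C) : Prop :=
  ∃ θ : ∀ X Y : C, (X ⟶ Y) →ₗ[k] (X ⟶ Y), ∀ ⦃X Y Z : C⦄ (x : X ⟶ Y) (y : Y ⟶ Z),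
    f X Y Z x y = x ≫ θ Y Z y + θ X Y x ≫ y - θ X Z (x ≫ y)

variable {f : TwoCochain k C}

theorem TwoCochain.IsCocycle.apply_id_left (hf : f.IsCocycle) {X Y : C} (x : X ⟶ Y) :
    f X X Y (𝟙 X) x = f X X X (𝟙 X) (𝟙 X) ≫ x := by
  simpa using (hf (𝟙 X) (𝟙 X) x).symm

theorem TwoCochain.IsCocycle.apply_id_right (hf : f.IsCocycle) {X Y : C} (x : X ⟶ Y) :
    f X Y Y x (𝟙 Y) = x ≫ f Y Y Y (𝟙 Y) (𝟙 Y) := by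
  simpa using hf x (𝟙 Y) (𝟙 Y)

/-- The objects of the square-zero extension `C ⊕ ε C` of a linear category by itself that is
defined by the cocycle `f`: the composite of `x + ε x'` and `y + ε y'` is
`x ≫ y + ε (x ≫ y' + x' ≫ y + f x y)`. -/
structure SquareZeroExtension (hf : f.IsCocycle) where
  /-- The underlying object of `C`. -/
  base : C

namespace SquareZeroExtension

variable {hf : f.IsCocycle}

instance : Category (SquareZeroExtension hf) where
  Hom X Y := (X.base ⟶ Y.base) × (X.base ⟶ Y.base)
  id X := (𝟙 X.base, -f X.base X.base X.base (𝟙 X.base) (𝟙 X.base))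
  comp {X Y Z} x y := (x.1 ≫ y.1, x.1 ≫ y.2 + x.2 ≫ y.1 + f X.base Y.base Z.base x.1 y.1)
  id_comp x := by
    ext <;> simp [hf.apply_id_left x.1]
  comp_id x := by
    ext <;> simp [hf.apply_id_right x.1]
  assoc {W X Y Z} x y z := by
    ext
    · simp
    · have h := hf x.1 y.1 z.1
      simp only [Preadditive.comp_add, Preadditive.add_comp, Category.assoc]
      grind

/-- The projection `x + ε x' ↦ x`. -/
def proj (hf : f.IsCocycle) : SquareZeroExtension hf ⥤ C where
  obj X := X.base
  map x := x.1

theorem comp_snd {X Y Z : SquareZeroExtension hf} (x : X ⟶ Y) (y : Y ⟶ Z) :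
    (x ≫ y).2 = x.1 ≫ y.2 + x.2 ≫ y.1 + f X.base Y.base Z.base x.1 y.1 :=
  rfl

end SquareZeroExtension

end SquareZero

theorem delta_add_sub (i j l : ℕ) : delta i j l + (i - l) = (i - j) + (j - l) := by
  have h : 0 ≤ ((i : ℤ) - j) * ((j : ℤ) - l) ↔ (i ≤ j ∧ j ≤ l) ∨ (l ≤ j ∧ j ≤ i) := by
    rw [mul_nonneg_iff]
    omega
  simp only [delta, h]
  split_ifs <;> omega

theorem delta_of_le_of_le {i j l : ℕ} (h : i ≤ j) (h' : j ≤ l) : delta i j l = 0 := by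
  have := delta_add_sub i j l
  omega

theorem delta_of_ge_of_ge {i j l : ℕ} (h : j ≤ i) (h' : l ≤ j) : delta i j l = 0 := by
  have := delta_add_sub i j l
  omega

theorem delta_self_left (i j : ℕ) : delta i i j = 0 := by simp [delta]

theorem delta_self_right (i j : ℕ) : delta i j j = 0 := by simp [delta]

theorem delta_self_succ (i : ℕ) : delta (i + 1) i (i + 1) = 1 := by simp [delta]

theorem delta_succ_self (i : ℕ) : delta i (i + 1) i = 1 := by simp [delta]

theorem delta_cocycle (i j l n : ℕ) : delta i j l + delta i l n = delta j l n + delta i j n := by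
  have h1 := delta_add_sub i j l
  have h2 := delta_add_sub i l n
  have h3 := delta_add_sub j l n
  have h4 := delta_add_sub i j n
  omega

section Arrows

open CategoryTheory

universe v u v' u'

theorem end_pow_comp {E : Type u} [Category.{v} E] {X Y : E} {s : End X} {f : X ⟶ Y} {t : End Y}
    (h : s ≫ f = f ≫ t) (n : ℕ) : (s ^ n) ≫ f = f ≫ (t ^ n) := by
  induction n with
  | zero => exact (Category.id_comp f).trans (Category.comp_id f).symm
  | succ n ih =>
    rw [pow_succ, pow_succ, End.mul_def, End.mul_def, Category.assoc, ih, ← Category.assoc, h,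
      Category.assoc]

theorem fin_le_induction {N : ℕ} {i : Fin (N + 1)} {motive : ∀ j, i ≤ j → Prop}
    (refl : motive i le_rfl)
    (succ : ∀ (j : Fin N) (h : i ≤ j.castSucc), motive j.castSucc h →
      motive j.succ (h.trans j.castSucc_le_succ)) (j : Fin (N + 1)) (h : i ≤ j) : motive j h := by
  induction j using Fin.induction with
  | zero =>
    obtain rfl : i = 0 := Fin.le_zero_iff.1 h
    exact refl
  | succ j ih =>
    obtain rfl | h' := h.eq_or_lt
    · exact refl
    · exact succ j _ (ih (Fin.le_castSucc_iff.2 h'))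

variable {E : Type u} [Category.{v} E] {D : Type u'} [Category.{v'} D] {N : ℕ}

/-- A representation in `E`, on the objects `X 0, …, X N`, of the quiver with arrows
`p i : i ⟶ i + 1`, `q i : i + 1 ⟶ i` and loops `s i`, subject to the relations between the
generators of the KLRW category. -/
structure ArrowSystem (X : Fin (N + 1) → E) where
  /-- The arrow to the right. -/
  p (i : Fin N) : X i.castSucc ⟶ X i.succ
  /-- The arrow to the left. -/
  q (i : Fin N) : X i.succ ⟶ X i.castSucc
  /-- The loop, which adds a dot. -/
  s (i : Fin (N + 1)) : End (X i)
  p_comp_q (i : Fin N) : p i ≫ q i = s i.castSucc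
  q_comp_p (i : Fin N) : q i ≫ p i = s i.succ

namespace ArrowSystem

variable {X : Fin (N + 1) → E} (A : ArrowSystem X)

/-- The arrow system in the opposite category, with `p` and `q` exchanged. -/
def op : ArrowSystem fun i => Opposite.op (X i) where
  p i := (A.q i).op
  q i := (A.p i).op
  s i := (A.s i).op
  p_comp_q i := congrArg Quiver.Hom.op (A.p_comp_q i)
  q_comp_p i := congrArg Quiver.Hom.op (A.q_comp_p i)

/-- The image of an arrow system under a functor. -/
def map (F : E ⥤ D) : ArrowSystem fun i => F.obj (X i) where
  p i := F.map (A.p i)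
  q i := F.map (A.q i)
  s i := F.map (A.s i)
  p_comp_q i := by rw [← F.map_comp, p_comp_q]
  q_comp_p i := by rw [← F.map_comp, q_comp_p]

/-- The composite of the arrows to the right from `i` to `j`. -/
def up {i j : Fin (N + 1)} (h : i ≤ j) : X i ⟶ X j :=
  (ComposableArrows.mkOfObjOfMapSucc X A.p).map (homOfLE h)

/-- The composite of the arrows to the left from `j` to `i`. -/
def down {i j : Fin (N + 1)} (h : i ≤ j) : X j ⟶ X i := (A.op.up h).unop

theorem up_refl (i : Fin (N + 1)) : A.up (le_refl i) = 𝟙 (X i) :=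
  (ComposableArrows.mkOfObjOfMapSucc X A.p).map_id i

theorem up_trans {i j l : Fin (N + 1)} (h : i ≤ j) (h' : j ≤ l) :
    A.up h ≫ A.up h' = A.up (h.trans h') :=
  ((ComposableArrows.mkOfObjOfMapSucc X A.p).map_comp (homOfLE h) (homOfLE h')).symm

theorem up_succ {i : Fin (N + 1)} {j : Fin N} (h : i ≤ j.castSucc) :
    A.up (h.trans j.castSucc_le_succ) = A.up h ≫ A.p j := by
  rw [← A.up_trans h j.castSucc_le_succ]
  exact congrArg (A.up h ≫ ·) (ComposableArrows.mkOfObjOfMapSucc_map_succ X A.p j j.2)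

theorem down_refl (i : Fin (N + 1)) : A.down (le_refl i) = 𝟙 (X i) :=
  congrArg Quiver.Hom.unop (A.op.up_refl i)

theorem down_trans {i j l : Fin (N + 1)} (h : i ≤ j) (h' : j ≤ l) :
    A.down h' ≫ A.down h = A.down (h.trans h') :=
  congrArg Quiver.Hom.unop (A.op.up_trans h h')

theorem down_succ {i : Fin (N + 1)} {j : Fin N} (h : i ≤ j.castSucc) :
    A.down (h.trans j.castSucc_le_succ) = A.q j ≫ A.down h :=
  congrArg Quiver.Hom.unop (A.op.up_succ h)

theorem s_comp_p (i : Fin N) : A.s i.castSucc ≫ A.p i = A.p i ≫ A.s i.succ := by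
  rw [← p_comp_q, ← q_comp_p, Category.assoc]

theorem s_comp_up {i j : Fin (N + 1)} (h : i ≤ j) : A.s i ≫ A.up h = A.up h ≫ A.s j := by
  induction j, h using fin_le_induction with
  | refl => rw [up_refl, Category.id_comp, Category.comp_id]
  | succ j h ih => rw [up_succ, ← Category.assoc, ih, Category.assoc, s_comp_p, Category.assoc]

theorem s_comp_down {i j : Fin (N + 1)} (h : i ≤ j) : A.s j ≫ A.down h = A.down h ≫ A.s i :=
  congrArg Quiver.Hom.unop (A.op.s_comp_up h).symm

theorem up_comp_down {i j : Fin (N + 1)} (h : i ≤ j) :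
    A.up h ≫ A.down h = A.s i ^ ((j : ℕ) - i) := by
  induction j, h using fin_le_induction with
  | refl => rw [up_refl, down_refl, Nat.sub_self, Category.id_comp, pow_zero, End.one_def]
  | succ j h ih =>
    have e : ((j.succ : ℕ) - i) = ((j.castSucc : ℕ) - i) + 1 := Nat.succ_sub h
    rw [A.up_succ h, A.down_succ h, Category.assoc, ← Category.assoc (A.p j), p_comp_q,
      ← Category.assoc, ← s_comp_up, Category.assoc, ih, e, pow_succ, End.mul_def]

theorem down_comp_up {i j : Fin (N + 1)} (h : i ≤ j) :
    A.down h ≫ A.up h = A.s j ^ ((j : ℕ) - i) := by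
  induction j, h using fin_le_induction with
  | refl => rw [up_refl, down_refl, Nat.sub_self, Category.id_comp, pow_zero, End.one_def]
  | succ j h ih =>
    have e : ((j.succ : ℕ) - i) = ((j.castSucc : ℕ) - i) + 1 := Nat.succ_sub h
    rw [A.up_succ h, A.down_succ h, Category.assoc, ← Category.assoc (A.down h), ih,
      end_pow_comp (A.s_comp_p j), ← Category.assoc, q_comp_p, e, pow_succ', ← End.mul_def,
      ← pow_succ, pow_succ']

/-- The shortest path from `i` to `j`, the morphism `a_{ji}` of the KLRW category. -/
def path (i j : Fin (N + 1)) : X i ⟶ X j :=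
  if h : i ≤ j then A.up h else A.down (le_of_not_ge h)

theorem path_of_le {i j : Fin (N + 1)} (h : i ≤ j) : A.path i j = A.up h := dif_pos h

theorem path_of_ge {i j : Fin (N + 1)} (h : j ≤ i) : A.path i j = A.down h := by
  obtain rfl | h' := h.eq_or_lt
  · rw [path_of_le A le_rfl, up_refl, down_refl]
  · exact dif_neg h'.not_ge

theorem pow_comp_path (i j : Fin (N + 1)) (n : ℕ) :
    (A.s i ^ n) ≫ A.path i j = A.path i j ≫ (A.s j ^ n) := by
  refine end_pow_comp ?_ n
  obtain h | h := le_total i j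
  · rw [path_of_le A h, s_comp_up]
  · rw [path_of_ge A h, s_comp_down]

theorem path_comp_path (i j l : Fin (N + 1)) :
    A.path i j ≫ A.path j l = (A.s i ^ delta i j l) ≫ A.path i l := by
  have hδ := delta_add_sub i j l
  obtain hij | hij := le_total i j <;> obtain hjl | hjl := le_total j l
  · rw [path_of_le A hij, path_of_le A hjl, path_of_le A (hij.trans hjl), up_trans,
      delta_of_le_of_le hij hjl, pow_zero]
    exact (Category.id_comp _).symm
  · obtain hil | hil := le_total i l
    · rw [pow_comp_path, path_of_le A hij, path_of_ge A hjl, path_of_le A hil,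
        ← up_trans A hil hjl, Category.assoc, up_comp_down, show delta i j l = j - l by omega]
    · rw [path_of_le A hij, path_of_ge A hjl, path_of_ge A hil, ← down_trans A hil hij,
        ← Category.assoc, up_comp_down, show delta i j l = j - i by omega]
  · obtain hil | hil := le_total i l
    · rw [path_of_ge A hij, path_of_le A hjl, path_of_le A hil, ← up_trans A hij hil,
        ← Category.assoc, down_comp_up, show delta i j l = i - j by omega]
    · rw [pow_comp_path, path_of_ge A hij, path_of_le A hjl, path_of_ge A hil,
        ← down_trans A hjl hil, Category.assoc, down_comp_up, show delta i j l = l - j by omega]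
  · rw [path_of_ge A hij, path_of_ge A hjl, path_of_ge A (hjl.trans hij), down_trans,
      delta_of_ge_of_ge hij hjl, pow_zero]
    exact (Category.id_comp _).symm

/-- The shortest path from `i` to `j` with `α` dots, the morphism `a_{ji} s^α` of the KLRW
category. -/
def dotted (i j : Fin (N + 1)) (α : ℕ) : X i ⟶ X j := (A.s i ^ α) ≫ A.path i j

theorem dotted_comp_dotted (i j l : Fin (N + 1)) (α β : ℕ) :
    A.dotted i j α ≫ A.dotted j l β = A.dotted i l (β + α + delta i j l) :=
  calc
    _ = (A.s i ^ α) ≫ ((A.s i ^ β) ≫ A.path i j) ≫ A.path j l := by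
      rw [pow_comp_path, dotted, dotted, Category.assoc, Category.assoc]
    _ = (((A.s i ^ α) ≫ (A.s i ^ β)) ≫ (A.s i ^ delta i j l)) ≫ A.path i l := by
      simp only [Category.assoc, path_comp_path]
    _ = A.dotted i l (β + α + delta i j l) := by
      rw [← End.mul_def, ← End.mul_def, ← pow_add, ← pow_add, add_comm, dotted]

theorem map_up (F : E ⥤ D) {i j : Fin (N + 1)} (h : i ≤ j) :
    (A.map F).up h = F.map (A.up h) := by
  induction j, h using fin_le_induction with
  | refl => rw [up_refl, up_refl, F.map_id]
  | succ j h ih => rw [up_succ _ h, up_succ _ h, F.map_comp, ih]; rfl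

theorem map_down (F : E ⥤ D) {i j : Fin (N + 1)} (h : i ≤ j) :
    (A.map F).down h = F.map (A.down h) :=
  congrArg Quiver.Hom.unop (A.op.map_up F.op h)

theorem map_dotted (F : E ⥤ D) (i j : Fin (N + 1)) (α : ℕ) :
    (A.map F).dotted i j α = F.map (A.dotted i j α) := by
  have h : (A.map F).path i j = F.map (A.path i j) := by
    unfold path
    split_ifs
    · exact A.map_up F _
    · exact A.map_down F _
  rw [dotted, h, dotted, F.map_comp]
  exact congrArg (· ≫ F.map (A.path i j)) (map_pow (F.mapEnd (X i)) (A.s i) α).symm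

end ArrowSystem
end Arrows

section LinearCategory

variable {k : Type*} [Field k] {N : ℕ}

theorem comp_single (i j l : Ob N) (β α : ℕ) (b a : k) :
    comp k i j l (Finsupp.single β b) (Finsupp.single α a) =
      Finsupp.single (β + α + delta i j l) (b * a) := by
  simp [comp]

theorem comp_gen (i j l : Ob N) (β α : ℕ) :
    comp k i j l (gen k l j β) (gen k j i α) = gen k l i (β + α + delta i j l) := by
  rw [gen, gen, comp_single, mul_one, gen]

theorem comp_gen_zero_left (i j l : Ob N) (x : Mor k i j) :
    comp k i j l (gen k l j 0) x = Finsupp.mapDomain (· + delta i j l) x := by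
  simp [comp, gen, Finsupp.lmapDomain]

theorem comp_gen_zero_right (i j l : Ob N) (y : Mor k j l) :
    comp k i j l y (gen k j i 0) = Finsupp.mapDomain (· + delta i j l) y := by
  induction y using Finsupp.induction_linear with
  | zero => simp
  | add y y' h h' => rw [map_add, LinearMap.add_apply, h, h', Finsupp.mapDomain_add]
  | single β b => rw [gen, comp_single, Finsupp.mapDomain_single, mul_one, add_zero]

theorem comp_id_left (i j : Ob N) (x : Mor k i j) : comp k i j j (gen k j j 0) x = x := by
  rw [comp_gen_zero_left, delta_self_right]
  exact Finsupp.mapDomain_id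

theorem comp_id_right (i j : Ob N) (x : Mor k i j) : comp k i i j x (gen k i i 0) = x := by
  rw [comp_gen_zero_right, delta_self_left]
  exact Finsupp.mapDomain_id

theorem comp_assoc (i j l n : Ob N) (x : Mor k i j) (y : Mor k j l) (z : Mor k l n) :
    comp k i l n z (comp k i j l y x) = comp k i j n (comp k j l n z y) x := by
  induction x using Finsupp.induction_linear with
  | zero => simp
  | add x x' h h' => simp only [map_add, h, h']
  | single α a =>
  induction y using Finsupp.induction_linear with
  | zero => simp
  | add y y' h h' => simp only [map_add, LinearMap.add_apply, h, h']
  | single β b =>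
  induction z using Finsupp.induction_linear with
  | zero => simp
  | add z z' h h' => simp only [map_add, LinearMap.add_apply, h, h']
  | single γ c =>
  simp only [comp_single, mul_assoc]
  have := delta_cocycle i j l n
  congr 1
  omega

theorem comp_apply_zero {i j l : Ob N} (h : delta i j l ≠ 0) (y : Mor k j l) (x : Mor k i j) :
    comp k i j l y x 0 = 0 := by
  induction y using Finsupp.induction_linear with
  | zero => simp
  | add y y' h h' => rw [map_add, LinearMap.add_apply, Finsupp.add_apply, h, h', add_zero]
  | single β b =>
  induction x using Finsupp.induction_linear with
  | zero => simp
  | add x x' h h' => rw [map_add, Finsupp.add_apply, h, h', add_zero]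
  | single α a =>
  rw [comp_single, Finsupp.single_eq_of_ne (by omega)]

open CategoryTheory

/-- The objects of the KLRW category, regarded as a linear category: all its morphisms have
degree `0`, so it is one. Morphisms are composed in diagrammatic order. -/
structure KLRWCat (k : Type*) (N : ℕ) where
  /-- The index `i` of the object `T_i`. -/
  idx : Ob N

instance : Category (KLRWCat k N) where
  Hom X Y := Mor k X.idx Y.idx
  id X := gen k X.idx X.idx 0
  comp {X Y Z} x y := comp k X.idx Y.idx Z.idx y x
  id_comp {X Y} x := comp_id_right X.idx Y.idx x
  comp_id {X Y} x := comp_id_left X.idx Y.idx x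
  assoc {W X Y Z} x y z := comp_assoc W.idx X.idx Y.idx Z.idx x y z

instance : Preadditive (KLRWCat k N) where
  homGroup X Y := inferInstanceAs (AddCommGroup (Mor k X.idx Y.idx))
  add_comp X Y Z x x' y := (comp k X.idx Y.idx Z.idx y).map_add x x'
  comp_add X Y Z x y y' := LinearMap.map_add₂ (comp k X.idx Y.idx Z.idx) y y' x

instance : Linear k (KLRWCat k N) where
  homModule X Y := inferInstanceAs (Module k (Mor k X.idx Y.idx))
  smul_comp X Y Z c x y := (comp k X.idx Y.idx Z.idx y).map_smul c x
  comp_smul X Y Z x c y := LinearMap.map_smul₂ (comp k X.idx Y.idx Z.idx) c y x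

/-- The generators of the KLRW category. -/
def arrows (k : Type*) [Field k] (N : ℕ) : ArrowSystem fun i => KLRWCat.mk (k := k) (N := N) i where
  p i := gen k i.succ i.castSucc 0
  q i := gen k i.castSucc i.succ 0
  s i := gen k i i 1
  p_comp_q i := (comp_gen _ _ _ 0 0).trans
    (congrArg (gen k _ _) ((zero_add _).trans (delta_succ_self i)))
  q_comp_p i := (comp_gen _ _ _ 0 0).trans
    (congrArg (gen k _ _) ((zero_add _).trans (delta_self_succ i)))

theorem arrows_pow (i : Ob N) (n : ℕ) : (arrows k N).s i ^ n = gen k i i n := by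
  induction n with
  | zero => rfl
  | succ n ih =>
    rw [pow_succ, End.mul_def, ih]
    refine (comp_gen _ _ _ _ _).trans (congrArg (gen k _ _) ?_)
    rw [delta_self_left, add_zero]

theorem arrows_up {i j : Ob N} (h : i ≤ j) : (arrows k N).up h = gen k j i 0 := by
  induction j, h using fin_le_induction with
  | refl => exact (arrows k N).up_refl i
  | succ j h ih =>
    rw [ArrowSystem.up_succ _ h, ih]
    exact (comp_gen _ _ _ 0 0).trans
      (congrArg (gen k _ _) ((zero_add _).trans (delta_of_le_of_le h (Nat.le_succ j))))

theorem arrows_down {i j : Ob N} (h : i ≤ j) : (arrows k N).down h = gen k i j 0 := by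
  induction j, h using fin_le_induction with
  | refl => exact (arrows k N).down_refl i
  | succ j h ih =>
    rw [ArrowSystem.down_succ _ h, ih]
    exact (comp_gen _ _ _ 0 0).trans
      (congrArg (gen k _ _) ((zero_add _).trans (delta_of_ge_of_ge (Nat.le_succ j) h)))

theorem arrows_dotted (i j : Ob N) (α : ℕ) : (arrows k N).dotted i j α = gen k j i α := by
  have hpath : (arrows k N).path i j = gen k j i 0 := by
    unfold ArrowSystem.path
    split_ifs
    · exact arrows_up _
    · exact arrows_down _
  rw [ArrowSystem.dotted, arrows_pow, hpath]
  refine (comp_gen _ _ _ _ _).trans (congrArg (gen k _ _) ?_)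
  rw [delta_self_left, zero_add, add_zero]

end LinearCategory

section Multilinear

variable {R : Type*} [CommRing R]

/-- Multilinear maps in one variable are linear maps. -/
def multilinearEquivLinear (M : Fin 1 → Type*) (P : Type*) [∀ p, AddCommGroup (M p)]
    [∀ p, Module R (M p)] [AddCommGroup P] [Module R P] :
    MultilinearMap R M P ≃ₗ[R] M 0 →ₗ[R] P :=
  multilinearCurryLeftEquiv R M P ≪≫ₗ LinearEquiv.congrRight
    (MultilinearMap.constLinearEquivOfIsEmpty R R (fun p : Fin 0 => M p.succ) P).symm

/-- Multilinear maps in two variables are bilinear maps. -/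
def multilinearEquivBilinear (M : Fin 2 → Type*) (P : Type*) [∀ p, AddCommGroup (M p)]
    [∀ p, Module R (M p)] [AddCommGroup P] [Module R P] :
    MultilinearMap R M P ≃ₗ[R] M 0 →ₗ[R] M 1 →ₗ[R] P :=
  multilinearCurryLeftEquiv R M P ≪≫ₗ LinearEquiv.congrRight
    (multilinearEquivLinear (fun p : Fin 1 => M p.succ) P)

end Multilinear

section Components

open CategoryTheory

variable {k : Type*} [Field k] {N : ℕ}

/-- The component `η¹` as a 1-cochain. -/
def val₁ (η : Family k N) (X Y : KLRWCat k N) : (X ⟶ Y) →ₗ[k] (X ⟶ Y) :=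
  multilinearEquivLinear _ _ (η 1 ![X.idx, Y.idx])

/-- The component `η²` as a 2-cochain. -/
def val₂ : Family k N →ₗ[k] TwoCochain k (KLRWCat k N) where
  toFun η X Y Z := multilinearEquivBilinear _ _ (η 2 ![X.idx, Y.idx, Z.idx])
  map_add' _ _ := rfl
  map_smul' _ _ := rfl

/-- The family with only the component `θ¹`. -/
def ofVal₁ (θ : ∀ X Y : KLRWCat k N, (X ⟶ Y) →ₗ[k] (X ⟶ Y)) : Family k N
  | 1, X => (multilinearEquivLinear _ _).symm (θ ⟨X 0⟩ ⟨X 1⟩)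
  | _, _ => 0

/-- The family with only the component `f²`. -/
def ofVal₂ : TwoCochain k (KLRWCat k N) →ₗ[k] Family k N where
  toFun f
    | 2, X => (multilinearEquivBilinear _ _).symm (f ⟨X 0⟩ ⟨X 1⟩ ⟨X 2⟩)
    | _, _ => 0
  map_add' f g := by
    funext d X
    match d with
    | 2 => rfl
    | 0 | 1 | _ + 3 => exact (add_zero 0).symm
  map_smul' c f := by
    funext d X
    match d with
    | 2 => rfl
    | 0 | 1 | _ + 3 => exact (smul_zero c).symm

theorem family_congr (η : Family k N) (d : ℕ) {X Y : Fin (d + 1) → Ob N} (h : X = Y)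
    {a b : Fin d → ℕ →₀ k} (hab : a = b) : (η d X a : ℕ →₀ k) = η d Y b := by
  subst h hab
  rfl

theorem ev_one (η : Family k N) (X : ℕ → Ob N) (a : ∀ p, Mor k (X p) (X (p + 1))) :
    ev η 1 X a = val₁ η ⟨X 0⟩ ⟨X 1⟩ (a 0) := by
  refine family_congr η 1 ?_ ?_ <;> funext p <;> fin_cases p <;> rfl

theorem ev_two (η : Family k N) (X : ℕ → Ob N) (a : ∀ p, Mor k (X p) (X (p + 1))) :
    ev η 2 X a = val₂ η ⟨X 0⟩ ⟨X 1⟩ ⟨X 2⟩ (a 0) (a 1) := by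
  refine family_congr η 2 ?_ ?_ <;> funext p <;> fin_cases p <;> rfl

/-- Only the component `η^g` of `η` is nonzero. -/
def Supported (η : Family k N) (g : ℕ) : Prop := ∀ d, d ≠ g → η d = 0

theorem mu_supported : Supported (mu k N) 2
  | 0, _ | 1, _ | _ + 3, _ => rfl
  | 2, h => absurd rfl h

theorem ofVal₁_supported (θ : ∀ X Y : KLRWCat k N, (X ⟶ Y) →ₗ[k] (X ⟶ Y)) :
    Supported (ofVal₁ θ) 1
  | 0, _ | _ + 2, _ => rfl
  | 1, h => absurd rfl h

theorem ofVal₂_supported (f : TwoCochain k (KLRWCat k N)) : Supported (ofVal₂ f) 2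
  | 0, _ | 1, _ | _ + 3, _ => rfl
  | 2, h => absurd rfl h

theorem mem_preNat_iff (η : Family k N) (g : ℕ) : η ∈ PreNat k N g ↔ Supported η g := by
  constructor
  · intro h d hd
    funext X
    ext1 a
    have hdeg := h d X 0 a fun p => by simp [degPart]
    have hne : (g : ℤ) - d ≠ 0 := by omega
    simpa [degPart, hne] using hdeg
  · intro h d X e a ha
    obtain rfl | hd := eq_or_ne d g
    · by_cases he : ∀ p, e p = 0
      · simp [degPart, he]
      · obtain ⟨p, hp⟩ := not_forall.1 he
        have hzero : a p = 0 := by simpa [degPart, hp] using ha p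
        rw [MultilinearMap.map_coord_zero _ p hzero]
        exact Submodule.zero_mem _
    · rw [h d hd]
      exact Submodule.zero_mem _

theorem Supported.ev_eq_zero {η : Family k N} {g : ℕ} (h : Supported η g) {d : ℕ} (hd : d ≠ g)
    (X : ℕ → Ob N) (a : ∀ p, Mor k (X p) (X (p + 1))) : ev η d X a = 0 := by
  rw [ev, h d hd]
  rfl

theorem Supported.brace_eq_zero {η ζ : Family k N} {u v : ℕ} (hη : Supported η u)
    (hζ : Supported ζ v) {d n s : ℕ} (hn : n < d - s + 1) (h : ¬(s = v ∧ d - s + 1 = u))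
    (X : ℕ → Ob N) (a : ∀ p, Mor k (X p) (X (p + 1))) : brace η ζ d n s X a = 0 := by
  obtain rfl | hs := eq_or_ne s v
  · exact hη.ev_eq_zero (fun e => h ⟨rfl, e⟩) _ _
  · have hev : evFrom ζ n s X a = 0 := hζ.ev_eq_zero hs _ _
    rw [brace, hev]
    exact MultilinearMap.map_coord_zero _ (⟨n, hn⟩ : Fin (d - s + 1)) (by simp [contractMor])

theorem Supported.diffFun_eq_zero {η : Family k N} {g : ℕ} (h : Supported η g) {d : ℕ}
    (hd : d ≠ g + 1) (X : ℕ → Ob N) (a : ∀ p, Mor k (X p) (X (p + 1))) :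
    diffFun g η d X a = 0 := by
  rw [diffFun, sum_eq_zero, sum_eq_zero, sub_zero] <;>
    refine fun s hs => sum_eq_zero fun n hn => ?_ <;> rw [mem_range] at hs hn
  · rw [h.brace_eq_zero mu_supported hn (by omega), smul_zero]
  · rw [mu_supported.brace_eq_zero h hn (by omega), smul_zero]

theorem Supported.diffFun_succ {η : Family k N} {g : ℕ} (h : Supported η (g + 1)) (X : ℕ → Ob N)
    (a : ∀ p, Mor k (X p) (X (p + 1))) :
    diffFun (g + 1 : ℕ) η (g + 2) X a =
      brace (mu k N) η (g + 2) 0 (g + 1) X a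
        + (-1 : k) ^ g • brace (mu k N) η (g + 2) 1 (g + 1) X a
        - ∑ n ∈ range (g + 1), (-1 : k) ^ (g + n) • brace η (mu k N) (g + 2) n 2 X a := by
  have hsign (n : ℕ) : (-1 : k) ^ (maltese n + (g + 1 : ℕ) - 1) = (-1) ^ (g + n) := by
    rw [maltese, show -(n : ℤ) + (g + 1 : ℕ) - 1 = (g + n : ℕ) - 2 * n by push_cast; ring,
      zpow_sub₀ (by simp), zpow_natCast, Even.neg_one_zpow ⟨n, by ring⟩, div_one]
  refine (congrArg₂ (· - ·) (sum_eq_single (g + 1) (fun s _ hs => ?_) (by simp))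
    (sum_eq_single 2 (fun s _ hs => ?_) (by simp))).trans ?_
  · refine sum_eq_zero fun n hn => ?_
    rw [mu_supported.brace_eq_zero h (mem_range.1 hn) (by omega), smul_zero]
  · refine sum_eq_zero fun n hn => ?_
    rw [h.brace_eq_zero mu_supported (mem_range.1 hn) (by omega), smul_zero]
  · rw [show g + 2 - (g + 1) + 1 = 2 by omega, sum_range_succ, sum_range_one]
    simp only [hsign, Nat.add_sub_cancel]
    simp [maltese, ← inv_pow]

theorem Supported.diffFun_one {θ : Family k N} (h : Supported θ 1) (X : ℕ → Ob N)
    (a : ∀ p, Mor k (X p) (X (p + 1))) :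
    diffFun 1 θ 2 X a =
      comp k (X 0) (X 1) (X 2) (val₁ θ ⟨X 1⟩ ⟨X 2⟩ (a 1)) (a 0)
        + comp k (X 0) (X 1) (X 2) (a 1) (val₁ θ ⟨X 0⟩ ⟨X 1⟩ (a 0))
        - val₁ θ ⟨X 0⟩ ⟨X 2⟩ (comp k (X 0) (X 1) (X 2) (a 1) (a 0)) := by
  have e1 : brace (mu k N) θ 2 0 1 X a =
      comp k (X 0) (X 1) (X 2) (a 1) (val₁ θ ⟨X 0⟩ ⟨X 1⟩ (a 0)) :=
    congrArg (comp k (X 0) (X 1) (X 2) (a 1))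
      (ev_one θ (fun p => X (0 + p)) (fun p => a (0 + p)))
  have e2 : brace (mu k N) θ 2 1 1 X a =
      comp k (X 0) (X 1) (X 2) (val₁ θ ⟨X 1⟩ ⟨X 2⟩ (a 1)) (a 0) := by
    rw [← ev_one θ (fun p => X (1 + p)) (fun p => a (1 + p))]
    rfl
  have e3 : brace θ (mu k N) 2 0 2 X a =
      val₁ θ ⟨X 0⟩ ⟨X 2⟩ (comp k (X 0) (X 1) (X 2) (a 1) (a 0)) := ev_one θ _ _
  refine (h.diffFun_succ X a).trans ?_
  rw [sum_range_one, e1, e2, e3]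
  module

theorem Supported.diffFun_two {η : Family k N} (h : Supported η 2) (X : ℕ → Ob N)
    (a : ∀ p, Mor k (X p) (X (p + 1))) :
    diffFun 2 η 3 X a =
      comp k (X 0) (X 2) (X 3) (a 2) (val₂ η ⟨X 0⟩ ⟨X 1⟩ ⟨X 2⟩ (a 0) (a 1))
        + val₂ η ⟨X 0⟩ ⟨X 2⟩ ⟨X 3⟩ (comp k (X 0) (X 1) (X 2) (a 1) (a 0)) (a 2)
        - (comp k (X 0) (X 1) (X 3) (val₂ η ⟨X 1⟩ ⟨X 2⟩ ⟨X 3⟩ (a 1) (a 2)) (a 0)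
          + val₂ η ⟨X 0⟩ ⟨X 1⟩ ⟨X 3⟩ (a 0) (comp k (X 1) (X 2) (X 3) (a 2) (a 1))) := by
  have e1 : brace (mu k N) η 3 0 2 X a =
      comp k (X 0) (X 2) (X 3) (a 2) (val₂ η ⟨X 0⟩ ⟨X 1⟩ ⟨X 2⟩ (a 0) (a 1)) :=
    congrArg (comp k (X 0) (X 2) (X 3) (a 2))
      (ev_two η (fun p => X (0 + p)) (fun p => a (0 + p)))
  have e2 : brace (mu k N) η 3 1 2 X a =
      comp k (X 0) (X 1) (X 3) (val₂ η ⟨X 1⟩ ⟨X 2⟩ ⟨X 3⟩ (a 1) (a 2)) (a 0) := by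
    rw [← ev_two η (fun p => X (1 + p)) (fun p => a (1 + p))]
    rfl
  have e3 : brace η (mu k N) 3 0 2 X a =
      val₂ η ⟨X 0⟩ ⟨X 2⟩ ⟨X 3⟩ (comp k (X 0) (X 1) (X 2) (a 1) (a 0)) (a 2) := ev_two η _ _
  have e4 : brace η (mu k N) 3 1 2 X a =
      val₂ η ⟨X 0⟩ ⟨X 1⟩ ⟨X 3⟩ (a 0) (comp k (X 1) (X 2) (X 3) (a 2) (a 1)) := ev_two η _ _
  refine (h.diffFun_succ X a).trans ?_
  rw [sum_range_succ, sum_range_one, e1, e2, e3, e4]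
  module

theorem exists_composable (i j l n : Ob N) (x : Mor k i j) (y : Mor k j l) (z : Mor k l n) :
    ∃ (X : ℕ → Ob N) (a : ∀ p, Mor k (X p) (X (p + 1))),
      X 0 = i ∧ X 1 = j ∧ X 2 = l ∧ X 3 = n ∧ a 0 = x ∧ a 1 = y ∧ a 2 = z :=
  ⟨fun p => if p = 0 then i else if p = 1 then j else if p = 2 then l else n,
    fun p => if p = 0 then x else if p = 1 then y else z, by simp⟩

theorem mem_natTrans_iff (η : Family k N) :
    η ∈ NatTrans k N 2 ↔ Supported η 2 ∧ (val₂ η).IsCocycle := by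
  have hp : η ∈ PreNat k N 2 ↔ Supported η 2 := mem_preNat_iff η 2
  rw [NatTrans, Submodule.mem_inf, hp, LinearMap.mem_ker]
  refine and_congr_right fun h => ⟨fun hd W X Y Z x y z => ?_, fun hf => ?_⟩
  · obtain ⟨W⟩ := W
    obtain ⟨X⟩ := X
    obtain ⟨Y⟩ := Y
    obtain ⟨Z⟩ := Z
    obtain ⟨X, a, rfl, rfl, rfl, rfl, rfl, rfl, rfl⟩ := exists_composable _ _ _ _ x y z
    exact sub_eq_zero.1 ((h.diffFun_two X a).symm.trans (congrFun (congrFun (congrFun hd 3) X) a))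
  · funext d X a
    obtain rfl | hd := eq_or_ne d 3
    · exact (h.diffFun_two X a).trans (sub_eq_zero.2 (hf (W := ⟨X 0⟩) (X := ⟨X 1⟩) (Y := ⟨X 2⟩)
        (Z := ⟨X 3⟩) (a 0) (a 1) (a 2)))
    · exact h.diffFun_eq_zero hd X a

theorem mem_cobound_iff {η : Family k N} (hη : Supported η 2) :
    η ∈ Cobound k N 2 ↔ (val₂ η).IsCoboundary := by
  constructor
  · rintro ⟨-, θ, hθ, h⟩
    have hθ' : Supported θ 1 := (mem_preNat_iff θ 1).1 hθ
    refine ⟨val₁ θ, fun X Y Z x y => ?_⟩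
    obtain ⟨X⟩ := X
    obtain ⟨Y⟩ := Y
    obtain ⟨Z⟩ := Z
    obtain ⟨X, a, rfl, rfl, rfl, -, rfl, rfl, -⟩ := exists_composable _ _ _ Z x y 0
    exact (ev_two η X a).symm.trans
      ((congrFun (congrFun (congrFun h 2) X) a).symm.trans (hθ'.diffFun_one X a))
  · rintro ⟨θ, h⟩
    refine ⟨(mem_preNat_iff η 2).2 hη, ofVal₁ θ, (mem_preNat_iff _ 1).2 (ofVal₁_supported θ), ?_⟩
    funext d X a
    obtain rfl | hd := eq_or_ne d 2
    · exact ((ofVal₁_supported θ).diffFun_one X a).trans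
        ((h (X := ⟨X 0⟩) (Y := ⟨X 1⟩) (Z := ⟨X 2⟩) (a 0) (a 1)).symm.trans (ev_two η X a).symm)
    · exact ((ofVal₁_supported θ).diffFun_eq_zero hd X a).trans (hη.ev_eq_zero hd X a).symm

end Components

section StrandSum

variable {R : Type*} [CommRing R]

theorem sum_range_add_succ (u : ℕ → R) {n : ℕ} (hn : 0 < n) :
    ∑ t ∈ range n, (u t + u (t + 1)) = u 0 + ∑ t ∈ Ico 1 n, 2 * u t + u n := by
  induction n, hn using Nat.le_induction with
  | base => simp
  | succ n hn ih => rw [sum_range_succ, ih, sum_Ico_succ_top hn]; ring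

/-- The contributions of sliding a strand across `n` red strands, where `g t` is the parameter at
the position of the middle after `t` steps. The middle has `β` dots to start with and acquires one
more in each of the first `a` steps, in which the strand turns back. -/
def strandSum (g : ℕ → R) (a n : ℕ) (β : R) : R :=
  ∑ t ∈ range n, ((β + (min t a : ℕ)) * g t + (β + (min (t + 1) a : ℕ)) * g (t + 1))

theorem strandSum_succ (g : ℕ → R) (a n : ℕ) (β : R) :
    strandSum g a (n + 1) β =
      β * (g 0 + g 1) + if 0 < a then g 1 + strandSum (fun t => g (t + 1)) (a - 1) n (β + 1)
        else strandSum (fun t => g (t + 1)) (a - 1) n β := by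
  rw [strandSum, sum_range_succ']
  obtain _ | a := a
  · simp only [strandSum, Nat.min_zero, Nat.cast_zero, add_zero, lt_irrefl, if_false, Nat.zero_sub,
      Nat.zero_add]
    ring
  · have hdot : ∀ t, β + (min (t + 1) (a + 1) : ℕ) = β + 1 + (min t a : ℕ) := fun t => by
      rw [Nat.add_min_add_right]
      push_cast
      ring
    simp only [hdot, strandSum, Nat.add_sub_cancel, Nat.zero_min, Nat.cast_zero, a.succ_pos,
      if_true, Nat.zero_add]
    ring

theorem strandSum_of_lt (g : ℕ → R) {a n : ℕ} (h : a < n) (β : R) :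
    strandSum g a n β = β * g 0 + ∑ t ∈ Icc 1 a, 2 * (β + t) * g t
      + ∑ t ∈ Ioo a n, 2 * (β + a) * g t + (β + a) * g n := by
  have hsplit := sum_Ico_consecutive (fun t => 2 * ((β + (min t a : ℕ)) * g t))
    (Nat.succ_le_succ a.zero_le) h
  rw [strandSum, sum_range_add_succ (fun t => (β + (min t a : ℕ)) * g t) (by omega), ← hsplit,
    min_eq_right h.le]
  have h1 : ∑ t ∈ Ico 1 (a + 1), 2 * ((β + (min t a : ℕ)) * g t) =
      ∑ t ∈ Icc 1 a, 2 * (β + t) * g t := by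
    refine sum_congr rfl fun t ht => ?_
    rw [min_eq_left (by rw [mem_Icc] at ht; omega), mul_assoc]
  have h2 : ∑ t ∈ Ico (a + 1) n, 2 * ((β + (min t a : ℕ)) * g t) =
      ∑ t ∈ Ioo a n, 2 * (β + a) * g t := by
    refine sum_congr rfl fun t ht => ?_
    rw [min_eq_right (by rw [mem_Ioo] at ht; omega), mul_assoc]
  rw [h1, h2]
  simp [add_assoc]

theorem strandSum_of_ge (g : ℕ → R) {a n : ℕ} (hn : 0 < n) (h : n ≤ a) (β : R) :
    strandSum g a n β = β * g 0 + ∑ t ∈ Icc 1 n, 2 * (β + t) * g t - (β + n) * g n := by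
  have hmid : ∑ t ∈ Ico 1 n, 2 * ((β + (min t a : ℕ)) * g t) =
      ∑ t ∈ Ico 1 n, 2 * (β + t) * g t := by
    refine sum_congr rfl fun t ht => ?_
    rw [min_eq_left (by rw [mem_Ico] at ht; omega), mul_assoc]
  rw [strandSum, sum_range_add_succ (fun t => (β + (min t a : ℕ)) * g t) hn, hmid,
    min_eq_left h, ← sum_Ico_add_eq_sum_Icc hn]
  simp only [Nat.zero_min, Nat.cast_zero, add_zero]
  ring

end StrandSum

section Coefficient

variable {k : Type*} [Field k] (θ : ℕ → k)

theorem slideRight_eq_strandSum (l i n β : ℕ) :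
    slideRight θ l i n β = strandSum (fun t => θ (i + n - t)) (i + n - l) n (β : k) := by
  induction n generalizing β with
  | zero => rfl
  | succ n ih =>
    simp only [slideRight, strandSum_succ, ih, Nat.sub_pos_iff_lt, ← add_assoc, Nat.cast_add_one,
      Nat.add_sub_cancel, Nat.sub_zero, Nat.add_sub_add_right,
      show i + n + 1 - l - 1 = i + n - l by omega]

theorem slideLeft_eq_strandSum (l n j β : ℕ) :
    slideLeft θ l n j β = strandSum (fun t => θ (j + t)) (l - j) n (β : k) := by
  induction n generalizing j β with
  | zero => rfl
  | succ n ih =>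
    simp only [slideLeft, strandSum_succ, ih, Nat.sub_pos_iff_lt, Nat.cast_add_one,
      Nat.add_zero, Nat.sub_add_eq, add_assoc, add_comm 1]

theorem coeff_of_lt (l : ℕ) {j i : ℕ} (h : i < j) (β : ℕ) :
    coeff θ l j i β = -strandSum (fun t => θ (j - t)) (j - l) (j - i) (β : k) := by
  unfold coeff
  have hi : j - (j - i) = i := by omega
  split_ifs
  · rw [strandSum_of_lt _ (by omega), hi, show j - l = 0 by omega]
    simp only [Icc_eq_empty_of_lt one_pos, sum_empty, add_zero, Nat.cast_zero, Nat.sub_zero,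
      show Ioo 0 (j - i) = Ico 1 (j - i) from rfl]
    ring
  · rw [strandSum_of_lt _ (by omega), hi, Nat.sub_zero]
    ring
  · rw [strandSum_of_ge _ (by omega) (by omega), hi, Nat.sub_zero]
    ring
  all_goals omega

theorem coeff_of_gt (l : ℕ) {j i : ℕ} (h : j < i) (β : ℕ) :
    coeff θ l j i β = strandSum (fun t => θ (j + t)) (l - j) (i - j) (β : k) := by
  unfold coeff
  have hi : j + (i - j) = i := by omega
  split_ifs
  any_goals omega
  · rw [strandSum_of_lt _ (by omega), hi, show l - j = 0 by omega]
    simp only [Icc_eq_empty_of_lt one_pos, sum_empty, add_zero, Nat.cast_zero,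
      show Ioo 0 (i - j) = Ico 1 (i - j) from rfl]
  · rw [strandSum_of_lt _ (by omega), hi, add_zero]
  · rw [strandSum_of_ge _ (by omega) (by omega), hi, add_zero]

theorem coeff_self (l j β : ℕ) : coeff θ l j j β = 0 := by
  unfold coeff
  split_ifs
  any_goals omega
  rfl

theorem coeff_eq_slide (l j i β : ℕ) : coeff θ l j i β = slide θ l j i β := by
  unfold slide
  obtain h | rfl | h := lt_trichotomy i j
  · rw [if_pos h, coeff_of_lt θ l h, slideRight_eq_strandSum, Nat.add_sub_cancel' h.le]
  · simp [coeff_self, slideLeft]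
  · rw [if_neg h.not_gt, coeff_of_gt θ l h, slideLeft_eq_strandSum]

end Coefficient

section Primitive

variable {R : Type*} [CommRing R] (θ : ℕ → R)

/-- The number `θ_0 + 2 θ_1 + ⋯ + 2 θ_{m-1} + θ_m`: the 1-cochain `primitive θ` has the coefficient
`-slope θ m` at the loop `s_m`. -/
def slope (m : ℕ) : R := ∑ r ∈ range m, (θ r + θ (r + 1))

/-- The partial sums of `slope θ r + θ r`: the 1-cochain `primitive θ` has the coefficient
`-slopeSum θ m` at the path `a_{0m}`. -/
def slopeSum (m : ℕ) : R := ∑ r ∈ range m, (slope θ r + θ r)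

theorem slope_succ (m : ℕ) : slope θ (m + 1) = slope θ m + (θ m + θ (m + 1)) :=
  sum_range_succ _ _

theorem slopeSum_succ (m : ℕ) : slopeSum θ (m + 1) = slopeSum θ m + (slope θ m + θ m) :=
  sum_range_succ _ _

/-- The 1-cochain `a_{ji} s^α ↦ primitive θ i j α • a_{ji} s^{α-1}` over the Laurent polynomials
whose differential has the coefficients `coeff θ`. -/
def primitive : (ℕ → R) →ₗ[R] (ℕ → ℕ → ℕ → R) where
  toFun θ i j α := slopeSum θ (min i j) - slopeSum θ i - α * slope θ i
  map_add' θ θ' := by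
    funext i j α
    simp only [slopeSum, slope, Pi.add_apply, sum_add_distrib]
    ring
  map_smul' c θ := by
    funext i j α
    simp only [slopeSum, slope, Pi.smul_apply, smul_eq_mul, ← mul_add, ← mul_sum,
      RingHom.id_apply]
    ring

/-- The coefficient at `a_{li} s^{β+α+δ(i,j,l)-1}` of the value on `a_{ji} s^α`, `a_{lj} s^β` of the
differential of the 1-cochain `a_{ji} s^α ↦ φ i j α • a_{ji} s^{α-1}`. -/
def laurentCobound (φ : ℕ → ℕ → ℕ → R) (i j l α β : ℕ) : R :=
  φ j l β + φ i j α - φ i l (β + α + delta i j l)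

theorem laurentCobound_add (φ ψ : ℕ → ℕ → ℕ → R) (i j l α β : ℕ) :
    laurentCobound (φ + ψ) i j l α β = laurentCobound φ i j l α β + laurentCobound ψ i j l α β := by
  simp only [laurentCobound, Pi.add_apply]
  ring

theorem laurentCobound_smul (c : R) (φ : ℕ → ℕ → ℕ → R) (i j l α β : ℕ) :
    laurentCobound (c • φ) i j l α β = c * laurentCobound φ i j l α β := by
  simp only [laurentCobound, Pi.smul_apply, smul_eq_mul]
  ring

theorem laurentCobound_primitive (i j l α β : ℕ) :
    laurentCobound (primitive θ) i j l α β =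
      slopeSum θ (min j l) + slopeSum θ (min i j) - slopeSum θ (min i l) - slopeSum θ j
        + β * (slope θ i - slope θ j) + delta i j l * slope θ i := by
  simp only [laurentCobound, primitive, LinearMap.coe_mk, AddHom.coe_mk]
  push_cast
  ring

theorem laurentCobound_primitive_eq_zero {i j l : ℕ} (h : delta i j l = 0) (α : ℕ) :
    laurentCobound (primitive θ) i j l α 0 = 0 := by
  have hδ := delta_add_sub i j l
  have hmono : i ≤ j ∧ j ≤ l ∨ l ≤ j ∧ j ≤ i := by omega
  rw [laurentCobound_primitive, h]
  obtain ⟨hij, hjl⟩ | ⟨hlj, hji⟩ := hmono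
  · rw [min_eq_left hij, min_eq_left hjl, min_eq_left (hij.trans hjl)]
    simp
  · rw [min_eq_right hlj, min_eq_right hji, min_eq_right (hlj.trans hji)]
    simp

variable {k : Type*} [Field k] (θ : ℕ → k)

theorem slideRight_eq_laurentCobound (l i n α β : ℕ) :
    slideRight θ l i n β = -laurentCobound (primitive θ) i (i + n) l α β := by
  induction n generalizing β with
  | zero => simp [slideRight, laurentCobound_primitive, delta_self_left]
  | succ n ih =>
    have hδ : delta i (i + n + 1) l = delta i (i + n) l + if l < i + n + 1 then 1 else 0 := by
      have := delta_add_sub i (i + n) l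
      have := delta_add_sub i (i + n + 1) l
      split_ifs <;> omega
    simp only [slideRight, ih, laurentCobound_primitive, ← add_assoc, hδ, slope_succ,
      slopeSum_succ, min_eq_left (i.le_add_right n), min_eq_left (show i ≤ i + n + 1 by omega)]
    split_ifs with h
    · rw [min_eq_right h.le, min_eq_right (Nat.lt_succ_iff.1 h)]
      push_cast
      ring
    · rw [min_eq_left (not_lt.1 h), min_eq_left (by omega), slopeSum_succ]
      push_cast
      ring

theorem slideLeft_eq_laurentCobound (l n j α β : ℕ) :
    slideLeft θ l n j β = laurentCobound (primitive θ) (j + n) j l α β := by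
  induction n generalizing j β with
  | zero => simp [slideLeft, laurentCobound_primitive, delta_self_left]
  | succ n ih =>
    have hi : j + 1 + n = j + (n + 1) := by omega
    have hδ : delta (j + (n + 1)) j l =
        delta (j + (n + 1)) (j + 1) l + if j < l then 1 else 0 := by
      have := delta_add_sub (j + (n + 1)) j l
      have := delta_add_sub (j + (n + 1)) (j + 1) l
      split_ifs <;> omega
    simp only [slideLeft, ih, hi, laurentCobound_primitive, hδ, slope_succ θ j, slopeSum_succ θ j,
      min_eq_right (j.le_add_right (n + 1)), min_eq_right (show j + 1 ≤ j + (n + 1) by omega)]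
    split_ifs with h
    · rw [min_eq_left h.le, min_eq_left (Nat.succ_le_of_lt h), slopeSum_succ]
      push_cast
      ring
    · rw [min_eq_right (not_lt.1 h), min_eq_right (by omega)]
      push_cast
      ring

theorem coeff_eq_laurentCobound (i j l α β : ℕ) :
    coeff θ l j i β = laurentCobound (primitive θ) i j l α β := by
  rw [coeff_eq_slide, slide]
  split_ifs with h
  · rw [slideRight_eq_laurentCobound θ l i _ α, neg_neg, Nat.add_sub_cancel' h.le]
  · rw [slideLeft_eq_laurentCobound θ l _ j α, Nat.add_sub_cancel' (not_lt.1 h)]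

end Primitive

section LaurentComp

variable {R : Type*} [CommRing R]

/-- The bilinear map `a_{ji} s^α ⊗ a_{lj} s^β ↦ laurentCobound φ i j l α β • a_{li} s^{β+α+δ-1}`,
where `δ = δ(i,j,l)`. The exponent is truncated at `0`, so this is the differential of a 1-cochain
over the Laurent polynomials only if the coefficient vanishes for `β + α + δ = 0`. -/
def laurentComp (i j l : ℕ) : (ℕ → ℕ → ℕ → R) →ₗ[R] (ℕ →₀ R) →ₗ[R] (ℕ →₀ R) →ₗ[R] (ℕ →₀ R) where
  toFun φ := Finsupp.linearCombination R fun α => Finsupp.linearCombination R fun β =>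
    Finsupp.single (β + α + delta i j l - 1) (laurentCobound φ i j l α β)
  map_add' φ ψ := by
    ext1 α
    ext1
    ext1 β
    ext1
    simp [laurentCobound_add, -Finsupp.single_mul]
  map_smul' c φ := by
    ext1 α
    ext1
    ext1 β
    ext1
    simp [laurentCobound_smul, -Finsupp.single_mul]

theorem laurentComp_single (φ : ℕ → ℕ → ℕ → R) (i j l α β : ℕ) (a b : R) :
    laurentComp i j l φ (Finsupp.single α a) (Finsupp.single β b) =
      Finsupp.single (β + α + delta i j l - 1) (a * b * laurentCobound φ i j l α β) := by
  simp [laurentComp, mul_assoc, -Finsupp.single_mul]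

theorem single_mul_laurentCobound {φ : ℕ → ℕ → ℕ → R} {i j l α β : ℕ}
    (h : β + α + delta i j l = 0 → laurentCobound φ i j l α β = 0) {m n : ℕ}
    (hmn : β + α + delta i j l ≠ 0 → m = n) {c d : R} (hcd : c = d * laurentCobound φ i j l α β) :
    Finsupp.single m c = Finsupp.single n c := by
  by_cases h0 : β + α + delta i j l = 0
  · rw [hcd, h h0, mul_zero, Finsupp.single_zero, Finsupp.single_zero]
  · rw [hmn h0]

end LaurentComp

section Laurent

open CategoryTheory

variable {k : Type*} [Field k] {N : ℕ}

/-- The bilinear maps `laurentComp` as a 2-cochain of the KLRW category. -/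
def laurentCochain : (ℕ → ℕ → ℕ → k) →ₗ[k] TwoCochain k (KLRWCat k N) where
  toFun φ X Y Z := laurentComp X.idx Y.idx Z.idx φ
  map_add' _ _ := by
    simp only [map_add]
    rfl
  map_smul' _ _ := by
    simp only [map_smul]
    rfl

theorem laurentComp_cocycle {φ : ℕ → ℕ → ℕ → k}
    (h : ∀ i j l α β, β + α + delta i j l = 0 → laurentCobound φ i j l α β = 0)
    (i j l n : Ob N) (x : Mor k i j) (y : Mor k j l) (z : Mor k l n) :
    comp k i l n z (laurentComp i j l φ x y) + laurentComp i l n φ (comp k i j l y x) z =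
      comp k i j n (laurentComp j l n φ y z) x + laurentComp i j n φ x (comp k j l n z y) := by
  induction x using Finsupp.induction_linear with
  | zero => simp
  | add x x' h h' =>
    simp only [map_add, LinearMap.add_apply]
    linear_combination (norm := module) h + h'
  | single α a =>
  induction y using Finsupp.induction_linear with
  | zero => simp
  | add y y' h h' =>
    simp only [map_add, LinearMap.add_apply]
    linear_combination (norm := module) h + h'
  | single β b =>
  induction z using Finsupp.induction_linear with
  | zero => simp
  | add z z' h h' =>
    simp only [map_add, LinearMap.add_apply]
    linear_combination (norm := module) h + h'
  | single γ c =>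
  have hδ := delta_cocycle i j l n
  simp only [comp_single, laurentComp_single]
  have hexp : γ + β + delta j l n + α + delta i j n =
      γ + (β + α + delta i j l) + delta i l n := by omega
  rw [hexp,
    single_mul_laurentCobound (h i j l α β) (n := γ + (β + α + delta i j l) + delta i l n - 1)
      (by omega) (mul_assoc c (a * b) _).symm,
    single_mul_laurentCobound (h j l n β γ) (n := γ + (β + α + delta i j l) + delta i l n - 1)
      (by omega) (mul_right_comm _ _ a),
    ← Finsupp.single_add, ← Finsupp.single_add]
  congr 1
  simp only [laurentCobound, hexp]
  ring

theorem isCocycle_laurentCochain {φ : ℕ → ℕ → ℕ → k}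
    (h : ∀ i j l α β, β + α + delta i j l = 0 → laurentCobound φ i j l α β = 0) :
    (laurentCochain φ : TwoCochain k (KLRWCat k N)).IsCocycle :=
  fun W X Y Z x y z => laurentComp_cocycle h W.idx X.idx Y.idx Z.idx x y z

theorem param_add (ϑ ϑ' : Fin (N - 1) → k) : param (ϑ + ϑ') = param ϑ + param ϑ' := by
  funext m
  simp only [param, Pi.add_apply]
  split_ifs <;> simp

theorem param_smul (c : k) (ϑ : Fin (N - 1) → k) : param (c • ϑ) = c • param ϑ := by
  funext m
  simp only [param, Pi.smul_apply]
  split_ifs <;> simp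

theorem isCocycle_laurentCochain_primitive (θ : ℕ → k) :
    (laurentCochain (primitive θ) : TwoCochain k (KLRWCat k N)).IsCocycle := by
  refine isCocycle_laurentCochain fun i j l α β h => ?_
  obtain rfl : β = 0 := by omega
  exact laurentCobound_primitive_eq_zero θ (by omega) α

/-- The natural transformations `η_ϑ`. -/
def slideTrans (k : Type*) [Field k] (N : ℕ) : (Fin (N - 1) → k) →ₗ[k] NatTrans k N 2 :=
  LinearMap.codRestrict _
    (ofVal₂ ∘ₗ laurentCochain ∘ₗ primitive ∘ₗ ⟨⟨param, param_add⟩, param_smul⟩) fun ϑ =>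
      (mem_natTrans_iff _).2 ⟨ofVal₂_supported _, isCocycle_laurentCochain_primitive (param ϑ)⟩

end Laurent

section Obstruction

open CategoryTheory

variable {k : Type*} [Field k] {N : ℕ} {f : TwoCochain k (KLRWCat k N)}

/-- The value of a 2-cochain on `p_i` and `q_i`. -/
def valPQ (f : TwoCochain k (KLRWCat k N)) (i : Fin N) : ℕ →₀ k :=
  f _ _ _ ((arrows k N).p i) ((arrows k N).q i)

/-- The value of a 2-cochain on `q_i` and `p_i`. -/
def valQP (f : TwoCochain k (KLRWCat k N)) (i : Fin N) : ℕ →₀ k :=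
  f _ _ _ ((arrows k N).q i) ((arrows k N).p i)

/-- The obstructions to lifting the relations `q_t p_t = p_{t+1} q_{t+1}` at the interior vertices
`t + 1` to the square-zero extension defined by a 2-cocycle. -/
def obstruction : TwoCochain k (KLRWCat k N) →ₗ[k] (Fin (N - 1) → k) where
  toFun f t := valQP f ⟨t, by omega⟩ 0 - valPQ f ⟨t + 1, by omega⟩ 0
  map_add' _ _ := funext fun _ => add_sub_add_comm _ _ _ _
  map_smul' c _ := funext fun _ => (mul_sub c _ _).symm

theorem obstruction_apply (f : TwoCochain k (KLRWCat k N)) (t : Fin (N - 1)) :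
    obstruction f t = valQP f ⟨t, by omega⟩ 0 - valPQ f ⟨t + 1, by omega⟩ 0 :=
  rfl

theorem p_comp (i : Fin N) (y : Mor k i.succ i.castSucc) :
    (arrows k N).p i ≫ (y : KLRWCat.mk i.succ ⟶ KLRWCat.mk i.castSucc) =
      Finsupp.mapDomain (· + 1) y :=
  (comp_gen_zero_right _ _ _ y).trans
    (congrArg (fun d => Finsupp.mapDomain (· + d) y) (delta_succ_self i))

theorem comp_p (i : Fin N) (x : Mor k i.succ i.castSucc) :
    (x : KLRWCat.mk i.succ ⟶ KLRWCat.mk i.castSucc) ≫ (arrows k N).p i =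
      Finsupp.mapDomain (· + 1) x :=
  (comp_gen_zero_left _ _ _ x).trans
    (congrArg (fun d => Finsupp.mapDomain (· + d) x) (delta_self_succ i))

/-- The coefficient of `a_{ji}`, the basis element without dots. -/
def constCoeff (X Y : KLRWCat k N) : (X ⟶ Y) →ₗ[k] k := Finsupp.lapply (R := k) (M := k) 0

theorem TwoCochain.IsCoboundary.exists_dot_value (hf : f.IsCoboundary) :
    ∃ c : Fin (N + 1) → k, ∀ i, valPQ f i 0 = c i.castSucc ∧ valQP f i 0 = c i.succ := by
  obtain ⟨θ, hθ⟩ := hf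
  have hconst {X Y : KLRWCat k N} (h : delta X.idx Y.idx X.idx ≠ 0) (x : X ⟶ Y) (y : Y ⟶ X) :
      constCoeff X X (f X Y X x y) = -constCoeff X X (θ X X (x ≫ y)) := by
    have h1 : constCoeff X X (x ≫ θ Y X y) = 0 := comp_apply_zero h (θ Y X y) x
    have h2 : constCoeff X X (θ X Y x ≫ y) = 0 := comp_apply_zero h y (θ X Y x)
    rw [hθ, map_sub, map_add, h1, h2, zero_add, zero_sub]
  refine ⟨fun v => -constCoeff ⟨v⟩ ⟨v⟩ (θ ⟨v⟩ ⟨v⟩ ((arrows k N).s v)), fun i => ⟨?_, ?_⟩⟩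
  · exact (hconst (X := ⟨i.castSucc⟩) (Y := ⟨i.succ⟩) (by simp [delta_succ_self]) _ _).trans
      (by rw [(arrows k N).p_comp_q])
  · exact (hconst (X := ⟨i.succ⟩) (Y := ⟨i.castSucc⟩) (by simp [delta_self_succ]) _ _).trans
      (by rw [(arrows k N).q_comp_p])

theorem exists_mapDomain_add_one {g : ℕ →₀ k} (h : g 0 = 0) :
    ∃ g' : ℕ →₀ k, Finsupp.mapDomain (· + 1) g' = g := by
  have hinj : Function.Injective (fun n : ℕ => n + 1) := add_left_injective 1
  refine ⟨g.comapDomain (· + 1) hinj.injOn, Finsupp.mapDomain_comapDomain _ hinj g fun n hn => ?_⟩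
  cases n with
  | zero => exact absurd h (Finsupp.mem_support_iff.1 hn)
  | succ n => exact ⟨n, rfl⟩

theorem exists_lift_of_apply_zero_eq (A B : Fin N → ℕ →₀ k)
    (h : ∀ t : Fin (N - 1), B ⟨t, by omega⟩ 0 = A ⟨t + 1, by omega⟩ 0) :
    ∃ (S : Fin (N + 1) → ℕ →₀ k) (Q : Fin N → ℕ →₀ k), ∀ i,
      Finsupp.mapDomain (· + 1) (Q i) + A i = S i.castSucc ∧
      Finsupp.mapDomain (· + 1) (Q i) + B i = S i.succ := by
  obtain _ | n := N
  · exact ⟨0, 0, fun i => i.elim0⟩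
  let S : Fin (n + 2) → ℕ →₀ k := fun v => A 0 + Fin.partialSum (B - A) v
  have hS (i : Fin (n + 1)) : S i.succ = S i.castSucc + (B i - A i) := by
    simp only [S, Fin.partialSum_succ, add_assoc, Pi.sub_apply]
  have hconst (i : Fin (n + 1)) : (S i.castSucc - A i) 0 = 0 := by
    induction i using Fin.induction with
    | zero => simp [S]
    | succ i ih =>
      rw [← Fin.succ_castSucc, hS]
      have hi : B i.castSucc 0 = A i.succ 0 := h i
      simp only [Finsupp.sub_apply, Finsupp.add_apply] at ih ⊢
      linear_combination ih + hi
  choose Q hQ using fun i => exists_mapDomain_add_one (hconst i)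
  refine ⟨S, Q, fun i => ⟨?_, ?_⟩⟩
  · rw [hQ, sub_add_cancel]
  · rw [hQ, hS]
    abel

theorem bilinear_ext_dotted {X Y Z : KLRWCat k N} {B B' : (X ⟶ Y) →ₗ[k] (Y ⟶ Z) →ₗ[k] (X ⟶ Z)}
    (h : ∀ α β, B ((arrows k N).dotted X.idx Y.idx α) ((arrows k N).dotted Y.idx Z.idx β) =
      B' ((arrows k N).dotted X.idx Y.idx α) ((arrows k N).dotted Y.idx Z.idx β)) : B = B' := by
  simp only [arrows_dotted] at h
  exact Finsupp.lhom_ext' (R := k) fun α => LinearMap.ext_ring <|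
    Finsupp.lhom_ext' (R := k) fun β => LinearMap.ext_ring (h α β)

theorem isCoboundary_of_dotted (θ : ∀ X Y : KLRWCat k N, (X ⟶ Y) →ₗ[k] (X ⟶ Y))
    (h : ∀ (i j l : Ob N) (α β : ℕ),
      f _ _ _ ((arrows k N).dotted i j α) ((arrows k N).dotted j l β) =
        (arrows k N).dotted i j α ≫ θ ⟨j⟩ ⟨l⟩ ((arrows k N).dotted j l β)
          + θ ⟨i⟩ ⟨j⟩ ((arrows k N).dotted i j α) ≫ (arrows k N).dotted j l β
          - θ ⟨i⟩ ⟨l⟩ ((arrows k N).dotted i j α ≫ (arrows k N).dotted j l β)) :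
    f.IsCoboundary :=
  ⟨θ, fun X Y Z => LinearMap.congr_fun₂ (f := f X Y Z)
    (g := (Linear.comp X Y Z).compl₂ (θ Y Z) + Linear.comp X Y Z ∘ₗ θ X Y
      - (Linear.comp X Y Z).compr₂ (θ X Z)) (bilinear_ext_dotted (h X.idx Y.idx Z.idx))⟩

theorem isCoboundary_of_arrowSystem (hf : f.IsCocycle)
    (A : ArrowSystem fun i => (⟨⟨i⟩⟩ : SquareZeroExtension hf))
    (hA : A.map (SquareZeroExtension.proj hf) = arrows k N) : f.IsCoboundary := by
  have hfst (i j : Ob N) (α : ℕ) : (A.dotted i j α).1 = (arrows k N).dotted i j α :=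
    (A.map_dotted (SquareZeroExtension.proj hf) i j α).symm.trans
      (congrArg (fun A' : ArrowSystem fun i => KLRWCat.mk i => A'.dotted i j α) hA)
  let θ (X Y : KLRWCat k N) : (X ⟶ Y) →ₗ[k] (X ⟶ Y) :=
    -Finsupp.linearCombination k fun α => (A.dotted X.idx Y.idx α).2
  have hθ (i j : Ob N) (α : ℕ) :
      θ ⟨i⟩ ⟨j⟩ ((arrows k N).dotted i j α) = -(A.dotted i j α).2 := by
    rw [arrows_dotted]
    exact congrArg Neg.neg ((Finsupp.linearCombination_single k 1 α).trans (one_smul k _))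
  refine isCoboundary_of_dotted θ fun i j l α β => ?_
  have h := congrArg Prod.snd (A.dotted_comp_dotted i j l α β)
  rw [SquareZeroExtension.comp_snd, hfst, hfst] at h
  rw [(arrows k N).dotted_comp_dotted, hθ, hθ, hθ, ← h, Preadditive.comp_neg,
    Preadditive.neg_comp]
  abel

theorem exists_arrowSystem (hf : f.IsCocycle) (h : obstruction f = 0) :
    ∃ A : ArrowSystem fun i => (⟨⟨i⟩⟩ : SquareZeroExtension hf),
      A.map (SquareZeroExtension.proj hf) = arrows k N := by
  obtain ⟨S, Q, hSQ⟩ := exists_lift_of_apply_zero_eq (valPQ f) (valQP f)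
    fun t => sub_eq_zero.1 (congrFun h t)
  refine ⟨{
    p := fun i => ((arrows k N).p i, 0)
    q := fun i => ((arrows k N).q i, Q i)
    s := fun i => ((arrows k N).s i, S i)
    p_comp_q := fun i => Prod.ext ((arrows k N).p_comp_q i) ?_
    q_comp_p := fun i => Prod.ext ((arrows k N).q_comp_p i) ?_ }, rfl⟩
  · rw [SquareZeroExtension.comp_snd, Limits.zero_comp, add_zero]
    exact (congrArg (· + _) (p_comp i (Q i))).trans (hSQ i).1
  · rw [SquareZeroExtension.comp_snd, Limits.comp_zero, zero_add]
    exact (congrArg (· + _) (comp_p i (Q i))).trans (hSQ i).2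

theorem isCoboundary_iff_obstruction_eq_zero (hf : f.IsCocycle) :
    f.IsCoboundary ↔ obstruction f = 0 := by
  constructor
  · intro h
    obtain ⟨c, hc⟩ := h.exists_dot_value
    exact funext fun t => sub_eq_zero.2 ((hc ⟨t, by omega⟩).2.trans (hc ⟨t + 1, by omega⟩).1.symm)
  · intro h
    obtain ⟨A, hA⟩ := exists_arrowSystem hf h
    exact isCoboundary_of_arrowSystem hf A hA

end Obstruction

section Classification

theorem bijective_mkQ_comp_of_comp_eq_smul {R V M : Type*} [CommRing R] [AddCommGroup V]
    [Module R V] [AddCommGroup M] [Module R M] {B : Submodule R M} {r : M →ₗ[R] V}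
    {η : V →ₗ[R] M} {c : R} (hB : LinearMap.ker r = B) (hc : IsUnit c)
    (hη : ∀ v, r (η v) = c • v) : Function.Bijective (B.mkQ ∘ₗ η) := by
  subst hB
  constructor
  · rw [injective_iff_map_eq_zero]
    intro v hv
    have hker : r (η v) = 0 := (Submodule.Quotient.mk_eq_zero _).1 hv
    exact hc.smul_eq_zero.1 ((hη v).symm.trans hker)
  · intro x
    obtain ⟨m, rfl⟩ := Submodule.mkQ_surjective _ x
    obtain ⟨u, rfl⟩ := hc
    refine ⟨u⁻¹ • r m, (Submodule.Quotient.eq _).2 ?_⟩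
    rw [LinearMap.mem_ker, map_sub, hη, ← Units.smul_def, smul_inv_smul, sub_self]

variable {k : Type*} [Field k] {N : ℕ}

theorem valQP_laurentCochain (φ : ℕ → ℕ → ℕ → k) (i : Fin N) :
    valQP (laurentCochain φ) i 0 = laurentCobound φ (i + 1) i (i + 1) 0 0 := by
  refine (DFunLike.congr_fun (laurentComp_single φ _ _ _ 0 0 1 1) 0).trans ?_
  simp [delta_self_succ]

theorem valPQ_laurentCochain (φ : ℕ → ℕ → ℕ → k) (i : Fin N) :
    valPQ (laurentCochain φ) i 0 = laurentCobound φ i (i + 1) i 0 0 := by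
  refine (DFunLike.congr_fun (laurentComp_single φ _ _ _ 0 0 1 1) 0).trans ?_
  simp [delta_succ_self]

theorem obstruction_laurentCochain_primitive (θ : ℕ → k) (t : Fin (N - 1)) :
    obstruction (N := N) (laurentCochain (primitive θ)) t = 2 * θ (t + 1) := by
  simp only [obstruction_apply, valQP_laurentCochain, valPQ_laurentCochain,
    laurentCobound_primitive]
  have hle : (t : ℕ) ≤ t + 1 := Nat.le_succ _
  have hle' : (t : ℕ) + 1 ≤ t + 1 + 1 := Nat.le_succ _
  simp only [delta_self_succ, delta_succ_self, slopeSum_succ, slope_succ, min_eq_left hle,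
    min_eq_right hle, min_eq_left hle', min_eq_right hle', min_self, Nat.cast_zero, Nat.cast_one]
  ring

/-- The obstruction of the component `η²` of a natural transformation. -/
def natTransObstruction (k : Type*) [Field k] (N : ℕ) : NatTrans k N 2 →ₗ[k] (Fin (N - 1) → k) :=
  obstruction ∘ₗ val₂ ∘ₗ Submodule.subtype _

theorem ker_natTransObstruction :
    LinearMap.ker (natTransObstruction k N) = (Cobound k N 2).submoduleOf (NatTrans k N 2) := by
  ext η
  obtain ⟨hη, hcocycle⟩ := (mem_natTrans_iff _).1 η.2
  exact ((mem_cobound_iff hη).trans (isCoboundary_iff_obstruction_eq_zero hcocycle)).symm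

theorem natTransObstruction_slideTrans (ϑ : Fin (N - 1) → k) :
    natTransObstruction k N (slideTrans k N ϑ) = (2 : k) • ϑ := by
  funext t
  refine (obstruction_laurentCochain_primitive (param ϑ) t).trans ?_
  rw [param, dif_pos (by omega)]
  rfl

theorem slideTrans_supported (ϑ : Fin (N - 1) → k) :
    Supported (slideTrans k N ϑ : Family k N) 2 :=
  ((mem_natTrans_iff _).1 (slideTrans k N ϑ).2).1

theorem ev_slideTrans (ϑ : Fin (N - 1) → k) (i j l : Ob N) (α β : ℕ) :
    ev (slideTrans k N ϑ : Family k N) 2 (fun p => if p = 0 then i else if p = 1 then j else l)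
        (fun p => if p = 0 then gen k j i α else gen k l j β) =
      coeff (param ϑ) l j i β • gen k l i (β + α + delta i j l - 1) := by
  refine (ev_two _ _ _).trans ((laurentComp_single (primitive (param ϑ)) i j l α β 1 1).trans ?_)
  rw [coeff_eq_laurentCobound _ i j l α β, gen, Finsupp.smul_single, smul_eq_mul, mul_one, mul_one,
    one_mul]

end Classification

end KLRW

end

theorem mainTheorem4 {k : Type*} [Field k] (h2 : (2 : k) ≠ 0) (N : ℕ) :
    ∃ η : (Fin (N - 1) → k) →ₗ[k] KLRW.NatTrans k N 2,
      (∀ (ϑ : Fin (N - 1) → k) (i j l : KLRW.Ob N) (α β : ℕ),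
        KLRW.ev (η ϑ : KLRW.Family k N) 2
            (fun p => if p = 0 then i else if p = 1 then j else l)
            (fun p => if p = 0 then KLRW.gen k j i α else KLRW.gen k l j β) =
          KLRW.coeff (KLRW.param ϑ) l j i β •
            KLRW.gen k l i (β + α + KLRW.delta i j l - 1)) ∧
      (∀ (ϑ : Fin (N - 1) → k) (d : ℕ), d ≠ 2 → (η ϑ : KLRW.Family k N) d = 0) ∧
      Function.Bijective (KLRW.HH.mk k N 2 ∘ₗ η) ∧
      (∀ (ϑ : Fin (N - 1) → k) (l j i : KLRW.Ob N) (β : ℕ),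
        KLRW.coeff (KLRW.param ϑ) l j i β = KLRW.slide (KLRW.param ϑ) l j i β) :=
  ⟨KLRW.slideTrans k N, KLRW.ev_slideTrans, KLRW.slideTrans_supported,
    KLRW.bijective_mkQ_comp_of_comp_eq_smul KLRW.ker_natTransObstruction h2.isUnit
      KLRW.natTransObstruction_slideTrans,
    fun ϑ l j i β => KLRW.coeff_eq_slide (KLRW.param ϑ) l j i β⟩
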